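/- **Setting.** Let $\mathcal X$ be a countable domain and $\mathcal H\subseteq\{0,1\}^{\mathcal X}$ a hypothesis class. A learner $\mathcal A$ maps a labeled sequence $S=((x_1,y_1),\dots,(x_m,y_m))$ to a predictor $\mathcal A(S):\mathcal X\to\{0,1\}$. For a probability distribution $\mathcal D$ on $\mathcal X$ its error rate is $$\epsilon_{\mathcal A}(\mathcal D,m)=\sup_{h\in\mathcal H}\ \mathbb E_{S}\ \Pr_{x\sim\mathcal D}\big[\mathcal A(S)(x)\ne h(x)\big],$$ where $S$ consists of $m$ independent samples from $\mathcal D$ labeled by $h$ (and the probability is also over the randomness of $\mathcal A$, if $\mathcal A$ is randomized). A sound certifier for $\mathcal A$ is a function $\mathcal C:\mathcal X^*\to[0,1]$ with $\mathbb E_{S\sim\mathcal D^m}[\mathcal C(S)]\ge\epsilon_{\mathcal A}(\mathcal D,m)$ for all distributions $\mathcal D$ on $\mathcal X$ and all $m$. A function $\epsilon(\mathcal D,m)\in[0,1]$ is certifiable if for every $\mathcal D$ there are a learner $\mathcal A$, which may depend on $\mathcal D$, and a sound certifier $\mathcal C$ for $\mathcal A$ such that $\mathbb E_{S\sim\mathcal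 D^m}[\mathcal C(S)]\le\epsilon(\mathcal D,m)$ for all $m$; it is certifiable for a given learner if that learner can be taken as $\mathcal A$ for every $\mathcal D$. For $\alpha>0$ and $\sigma:\mathbb N\times(0,1)\to\mathbb N$, a learner $\mathcal A$ is relatively $(\alpha,\sigma)$-smart (in the distribution-free setting) if $$\epsilon_{\mathcal A}(\mathcal D,\sigma(m,\eta))\le\alpha\,\epsilon(\mathcal D,m)+\eta$$ for every certifiable $\epsilon$, every distribution $\mathcal D$ on $\mathcal X$, every $m\in\mathbb N$ and every $\eta\in(0,1)$. ERM outputs a hypothesis in $\mathcal H$ of least average error on the training data; its error rate is evaluated with worst-case tie-breaking, i.e. $\epsilon_{\mathrm{ERM}}(\mathcal D,m)$ is the supremum of $\epsilon_{\mathcal A}(\mathcal D,m)$ over all such learners $\mathcal A$. A one-inclusion-graph (OIG) learner is a learner, possibly randomized, that minimizes among all possibly randomized learners the worst-case transductive error $$\sup_{h\in\mathcal H}\frac1n\sum_{i=1}^n\Pr\Big[\mathcal A\big(((x_j,h(x_j)))_{j\ne i}\big)(x_i)\ne h(x_i)\Big]$$ simultaneously for every $(x_1,\dots,x_n)\in\mathcal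 X^n$, $n\ge1$. The majority learner predicts, at every point, the most frequent label in the training data (and $1$ in case of a tie). **Theorem 3.1.** There is a hypothesis class $\mathcal H$ on a countable domain $\mathcal X$, for which OIG learners exist, such that for all constants $\alpha>0$ and $\beta>0$ and every $\sigma:\mathbb N\times(0,1)\to\mathbb N$ with $\sigma(m,\eta)=O_\eta(m^{2-\beta})$ as $m\to\infty$: 1. ERM is not relatively $(\alpha,\sigma)$-smart, and no OIG learner is relatively $(\alpha,\sigma)$-smart, in the distribution-free setting. 2. Moreover, the failure is relative to a rate that is certifiable for the majority learner. That is, there are a nonempty finite set $Y\subseteq\mathcal X$ with uniform distribution $\mathcal D_Y$, numbers $M,m\in\mathbb N$ and $\eta\in(0,1)$, and a rate $\epsilon$ that is certifiable for the majority learner, such that: on $Y$, each $h\in\mathcal H$ takes its less frequent label at most $M$ times; every subset of $Y$ with at most $M$ elements is shattered by $\mathcal H$; $\sigma(m,\eta)<M$ and $\alpha\,\epsilon(\mathcal D_Y,m)+\eta<\tfrac14$; and for every $k<M$, $\epsilon_{\mathrm{ERM}}(\mathcal D_Y,k)\ge\tfrac14$ and $\epsilon_{\mathcal A}(\mathcal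 D_Y,k)\ge\tfrac14$ for every OIG learner $\mathcal A$. -/

import Mathlib

open MeasureTheory Filter

namespace RelSmart

/-- A (deterministic, fully supervised) learner: from a sequence of `m` labeled examples it
outputs a predictor `X → {0,1}`. -/
abbrev Learner (X : Type) : Type := (m : ℕ) → (Fin m → X × Bool) → X → Bool

/-- A randomized learner, given by the probability with which it predicts the label `1` at the
test point. Expected 0-1 errors depend on nothing else, and every such table of probabilities
arises from independent rounding. -/
abbrev RandLearner (X : Type) : Type := (m : ℕ) → (Fin m → X × Bool) → X → unitInterval

/-- A certifier: from a finite unlabeled sample it computes a number in `[0,1]`. -/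
abbrev Certifier (X : Type) : Type := (m : ℕ) → (Fin m → X) → unitInterval

/-- A deterministic learner viewed as a randomized one. -/
def Learner.toRand {X : Type} (A : Learner X) : RandLearner X :=
  fun m S x => if A m S x = true then 1 else 0

/-- The labeled sequence `(s₁, h s₁), …, (sₘ, h sₘ)`. -/
def labeled {X : Type} (h : X → Bool) {m : ℕ} (s : Fin m → X) : Fin m → X × Bool :=
  fun i => (s i, h (s i))

/-- Probability of a wrong prediction, if `1` is predicted with probability `p` and the true
label is `y`. -/
def miss (p : unitInterval) (y : Bool) : ℝ :=
  if y = true then 1 - (p : ℝ) else (p : ℝ)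

section Rates

variable {X : Type} [MeasurableSpace X]

/-- Expectation of `f` over `m` i.i.d. draws from `D`. -/
noncomputable def expect (D : ProbabilityMeasure X) (m : ℕ) (f : (Fin m → X) → ℝ) : ℝ :=
  ∫ s, f s ∂(Measure.pi fun _ : Fin m => (D : Measure X))

/-- The expected error of `A` on `D` labeled by `h`, when trained on `m` i.i.d. samples. -/
noncomputable def expectedError (A : RandLearner X) (h : X → Bool)
    (D : ProbabilityMeasure X) (m : ℕ) : ℝ :=
  expect D m fun s => ∫ x, miss (A m (labeled h s) x) (h x) ∂(D : Measure X)

/-- The distribution-dependent error rate of a learner: worst case over the hypotheses. -/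
noncomputable def errorRate (H : Set (X → Bool)) (A : RandLearner X)
    (D : ProbabilityMeasure X) (m : ℕ) : ℝ :=
  ⨆ h : H, expectedError A h D m

/-- `C` never underestimates, in expectation, the error of `A`, whatever the distribution. -/
def IsSound (H : Set (X → Bool)) (A : Learner X) (C : Certifier X) : Prop :=
  ∀ (D : ProbabilityMeasure X) (m : ℕ),
    errorRate H A.toRand D m ≤ expect D m fun s => (C m s : ℝ)

/-- On the distribution `D`, the rate `m ↦ r m` is certified for the learner `A` by some
certifier that is sound for `A` on all distributions. -/
def CertifiedAt (H : Set (X → Bool)) (A : Learner X) (D : ProbabilityMeasure X)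
    (r : ℕ → unitInterval) : Prop :=
  ∃ C : Certifier X, IsSound H A C ∧ ∀ m, (expect D m fun s => (C m s : ℝ)) ≤ (r m : ℝ)

/-- Certifiable error rates in the distribution-free setting. The learner may be tailored
to `D`. -/
def Certifiable (H : Set (X → Bool)) (ε : ProbabilityMeasure X → ℕ → unitInterval) : Prop :=
  ∀ D : ProbabilityMeasure X, ∃ A : Learner X, CertifiedAt H A D (ε D)

/-- The inequality that defines relatively `(α, σ)`-smart learning, for a learner whose
distribution-dependent error rate is `r`. -/
def IsRelativelySmartRate (H : Set (X → Bool)) (r : ProbabilityMeasure X → ℕ → ℝ)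
    (α : ℝ) (σ : ℕ → Set.Ioo (0 : ℝ) 1 → ℕ) : Prop :=
  ∀ ε : ProbabilityMeasure X → ℕ → unitInterval, Certifiable H ε →
    ∀ (D : ProbabilityMeasure X) (m : ℕ) (η : Set.Ioo (0 : ℝ) 1),
      r D (σ m η) ≤ α * (ε D m : ℝ) + (η : ℝ)

/-- Relatively `(α, σ)`-smart learners in the distribution-free setting. -/
def IsRelativelySmart (H : Set (X → Bool)) (A : RandLearner X)
    (α : ℝ) (σ : ℕ → Set.Ioo (0 : ℝ) 1 → ℕ) : Prop :=
  IsRelativelySmartRate H (errorRate H A) α σ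

end Rates

section Learners

variable {X : Type}

/-- The average 0-1 error of a predictor on labeled data. -/
noncomputable def empiricalError (f : X → Bool) {m : ℕ} (S : Fin m → X × Bool) : ℝ :=
  (∑ i, if f (S i).1 = (S i).2 then (0 : ℝ) else 1) / m

/-- Empirical risk minimizers: they output a hypothesis of `H` of least error on the training
data. -/
def IsERM (H : Set (X → Bool)) (A : Learner X) : Prop :=
  ∀ (m : ℕ) (S : Fin m → X × Bool),
    A m S ∈ H ∧ ∀ h ∈ H, empiricalError (A m S) S ≤ empiricalError h S

/-- The error rate of ERM, with worst-case tie-breaking. -/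
noncomputable def ermErrorRate [MeasurableSpace X] (H : Set (X → Bool))
    (D : ProbabilityMeasure X) (m : ℕ) : ℝ :=
  ⨆ A : {A : Learner X // IsERM H A}, errorRate H A.1.toRand D m

/-- Worst-case transductive (leave-one-out) error of `A` on the nonempty unlabeled dataset
`(s₀, …, sₙ)`. -/
noncomputable def transError (H : Set (X → Bool)) (A : RandLearner X) {n : ℕ}
    (s : Fin (n + 1) → X) : ℝ :=
  ⨆ h : H, (∑ i : Fin (n + 1),
    miss (A n (i.removeNth (labeled h.1 s)) (s i)) (h.1 (s i))) / ((n : ℝ) + 1)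

/-- One-inclusion-graph learners: they minimize, among all (randomized) learners, the worst-case
transductive error, simultaneously on all unlabeled datasets. -/
def IsOIG (H : Set (X → Bool)) (A : RandLearner X) : Prop :=
  ∀ (B : RandLearner X) (n : ℕ) (s : Fin (n + 1) → X), transError H A s ≤ transError H B s

/-- The majority learner: it predicts the most frequent training label everywhere (and `1` in
case of a tie). -/
def majority (X : Type) : Learner X :=
  fun m S _ => decide (m ≤ 2 * (Finset.univ.filter fun i => (S i).2 = true).card)

/-- `H` realizes all labelings of the finite set `T`. -/
def Shatters (H : Set (X → Bool)) (T : Finset X) : Prop :=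
  ∀ g : X → Bool, ∃ h ∈ H, ∀ x ∈ T, h x = g x

/-- The number of points of `Y` that carry the less frequent label of `h` on `Y`. -/
def minorityCount (h : X → Bool) (Y : Finset X) : ℕ :=
  min (Y.filter fun x => h x = true).card (Y.filter fun x => h x = false).card

/-- The uniform distribution on a nonempty finite set. -/
noncomputable def unif [MeasurableSpace X] (Y : Finset X) (hY : Y.Nonempty) :
    ProbabilityMeasure X :=
  ⟨(PMF.uniformOfFinset Y hY).toMeasure, PMF.toMeasure.isProbabilityMeasure _⟩

end Learners

end RelSmart

/-!
The class consists of the labelings of `ℕ × ℕ` that are constant except on at most `N` points of a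
single row `{N} × ℕ`. It shatters every set of at most `N` points of row `N`, so on the first `n`
points of the row, with `n` large compared with `N²`, fewer than `N` examples teach nothing about
the other points unless one knows that the labels are almost constant. ERM may answer with the
complement of its sample (`quarter_le_ermErrorRate`). An OIG learner has worst-case transductive
error at most `1/2` on a shattered dataset; as the average over all labelings is `1/2` for every
learner, its leave-one-out error is exactly `1/2` for each labeling (`looError_eq_half`), and
averaging over the choice of the test point turns this into a lower bound for its expected error
(`quarter_le_errorRate_of_isOIG`).

The majority learner errs with probability at most three times the mass `p` of the minority points
(`expectedError_majority_le`), which is small under the uniform distribution. This can be certified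
from an unlabeled sample: if `N` points have mass `p` and `m p` is large compared with `√N`, a
sample of size `m` is likely to contain a repetition (`iid_injective_le`). So it is sound to certify
a multiple of `√N / m` if all points are distinct, and `1` otherwise (`isSound_birthdayCertifier`).
The absolute bound `9/16` on the majority error matters here, because repetitions occur only with
probability bounded away from `0`, and not with probability `1`.

With `N = j²` and `m = K j` the certified rate on a long row is of order `1 / K`, whereas ERM and
OIG learners need `N = m² / K²` examples, more than any `O(m ^ (2 - β))`.

OIG learners exist (`exists_isOIG`) by compactness on each single dataset. Two datasets share
inputs of the learner only if one is a reordering of the other, and the optimal solutions for the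
different multisets of points can be patched together.
-/

namespace RelSmart


/-! ### Errors and error rates -/

section Basic

variable {X : Type}

lemma miss_nonneg (p : unitInterval) (y : Bool) : 0 ≤ miss p y := by
  unfold miss
  split_ifs
  · linarith [p.2.2]
  · exact p.2.1

lemma miss_le_one (p : unitInterval) (y : Bool) : miss p y ≤ 1 := by
  unfold miss
  split_ifs
  · linarith [p.2.1]
  · exact p.2.2

lemma miss_add_miss_not (p : unitInterval) (y : Bool) : miss p y + miss p (!y) = 1 := by
  cases y <;> simp [miss]

lemma miss_toRand (A : Learner X) {m : ℕ} (S : Fin m → X × Bool) (x : X) (y : Bool) :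
    miss (A.toRand m S x) y = if A m S x = y then 0 else 1 := by
  unfold miss Learner.toRand
  cases A m S x <;> cases y <;> simp

variable [MeasurableSpace X]

lemma integrable_of_abs_le {Ω : Type} [MeasurableSpace Ω] [DiscreteMeasurableSpace Ω]
    (μ : Measure Ω) [IsFiniteMeasure μ] (f : Ω → ℝ) (c : ℝ) (h : ∀ x, |f x| ≤ c) :
    Integrable f μ :=
  Integrable.of_bound Measurable.of_discrete.aestronglyMeasurable c (ae_of_all _ h)

lemma integral_mem_unitInterval {Ω : Type} [MeasurableSpace Ω]
    (μ : Measure Ω) [IsProbabilityMeasure μ] (f : Ω → ℝ) (h0 : ∀ x, 0 ≤ f x)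
    (h1 : ∀ x, f x ≤ 1) : ∫ x, f x ∂μ ∈ unitInterval := by
  refine ⟨integral_nonneg h0, ?_⟩
  have := integral_mono_of_nonneg (ae_of_all _ h0) (integrable_const (μ := μ) (1 : ℝ))
    (ae_of_all _ h1)
  simpa using this

lemma expectedError_mem (A : RandLearner X) (h : X → Bool) (D : ProbabilityMeasure X) (m : ℕ) :
    expectedError A h D m ∈ unitInterval := by
  have key : ∀ s : Fin m → X,
      ∫ x, miss (A m (labeled h s) x) (h x) ∂(D : Measure X) ∈ unitInterval := fun s =>
    integral_mem_unitInterval _ _ (fun x => miss_nonneg _ _) (fun x => miss_le_one _ _)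
  exact integral_mem_unitInterval _ _ (fun s => (key s).1) (fun s => (key s).2)

lemma expectedError_le_errorRate {H : Set (X → Bool)} (A : RandLearner X) {h : X → Bool}
    (hh : h ∈ H) (D : ProbabilityMeasure X) (m : ℕ) :
    expectedError A h D m ≤ errorRate H A D m := by
  refine le_ciSup (f := fun h : H => expectedError A h D m) ⟨1, ?_⟩ ⟨h, hh⟩
  rintro _ ⟨g, rfl⟩
  exact (expectedError_mem A g D m).2

lemma errorRate_le {H : Set (X → Bool)} (A : RandLearner X) (D : ProbabilityMeasure X) (m : ℕ)
    {c : ℝ} (hc : 0 ≤ c) (hle : ∀ h ∈ H, expectedError A h D m ≤ c) :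
    errorRate H A D m ≤ c :=
  Real.iSup_le (fun h => hle h h.2) hc

lemma errorRate_le_one (H : Set (X → Bool)) (A : RandLearner X) (D : ProbabilityMeasure X)
    (m : ℕ) : errorRate H A D m ≤ 1 :=
  errorRate_le A D m zero_le_one fun h _ => (expectedError_mem A h D m).2

lemma errorRate_le_ermErrorRate {H : Set (X → Bool)} {A : Learner X} (hA : IsERM H A)
    (D : ProbabilityMeasure X) (m : ℕ) :
    errorRate H A.toRand D m ≤ ermErrorRate H D m := by
  refine le_ciSup (f := fun A : {A : Learner X // IsERM H A} => errorRate H A.1.toRand D m)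
    ⟨1, ?_⟩ ⟨A, hA⟩
  rintro _ ⟨B, rfl⟩
  exact errorRate_le_one _ _ _ _

end Basic

/-! ### Existence of one-inclusion-graph learners -/

section OIG

variable {X : Type}

/-- The summed leave-one-out error of `A` on the dataset `s` labeled by `h`. -/
noncomputable def looError (A : RandLearner X) (h : X → Bool) {n : ℕ} (s : Fin (n + 1) → X) : ℝ :=
  ∑ i : Fin (n + 1), miss (A n (i.removeNth (labeled h s)) (s i)) (h (s i))

lemma looError_nonneg (A : RandLearner X) (h : X → Bool) {n : ℕ} (s : Fin (n + 1) → X) :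
    0 ≤ looError A h s :=
  Finset.sum_nonneg fun _ _ => miss_nonneg _ _

lemma looError_le (A : RandLearner X) (h : X → Bool) {n : ℕ} (s : Fin (n + 1) → X) :
    looError A h s ≤ n + 1 := by
  calc looError A h s ≤ ∑ _i : Fin (n + 1), (1 : ℝ) :=
        Finset.sum_le_sum fun _ _ => miss_le_one _ _
    _ = n + 1 := by simp

lemma bddAbove_looError (H : Set (X → Bool)) (A : RandLearner X) {n : ℕ}
    (s : Fin (n + 1) → X) :
    BddAbove (Set.range fun h : H => looError A h.1 s / ((n : ℝ) + 1)) := by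
  refine ⟨1, ?_⟩
  rintro _ ⟨g, rfl⟩
  exact div_le_one_of_le₀ (looError_le _ _ _) (by positivity)

lemma looError_le_transError {H : Set (X → Bool)} (A : RandLearner X) {h : X → Bool} (hh : h ∈ H)
    {n : ℕ} (s : Fin (n + 1) → X) :
    looError A h s / ((n : ℝ) + 1) ≤ transError H A s :=
  le_ciSup (f := fun h : H => looError A h.1 s / ((n : ℝ) + 1))
    (bddAbove_looError H A s) ⟨h, hh⟩

lemma transError_le {H : Set (X → Bool)} (A : RandLearner X) {n : ℕ} (s : Fin (n + 1) → X) {c : ℝ}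
    (hc : 0 ≤ c) (hle : ∀ h ∈ H, looError A h s / ((n : ℝ) + 1) ≤ c) : transError H A s ≤ c :=
  Real.iSup_le (fun h => hle h.1 h.2) hc

lemma transError_nonneg (H : Set (X → Bool)) (A : RandLearner X) {n : ℕ}
    (s : Fin (n + 1) → X) : 0 ≤ transError H A s :=
  Real.iSup_nonneg fun h => div_nonneg (looError_nonneg A h.1 s) (by positivity)

lemma continuous_looError (h : X → Bool) {n : ℕ} (s : Fin (n + 1) → X) :
    Continuous fun A : RandLearner X => looError A h s := by
  unfold looError miss
  refine continuous_finsetSum _ fun i _ => ?_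
  split_ifs <;> fun_prop

/-- On a single dataset an optimal learner exists: learners form a compact space by Tychonoff's
theorem, and the worst-case transductive error is lower semicontinuous. -/
lemma exists_min_transError {H : Set (X → Bool)} (hH : H.Nonempty) {n : ℕ}
    (s : Fin (n + 1) → X) :
    ∃ A : RandLearner X, ∀ B : RandLearner X, transError H A s ≤ transError H B s := by
  have hlsc : LowerSemicontinuous fun A : RandLearner X => transError H A s := by
    have : Nonempty H := hH.to_subtype
    refine lowerSemicontinuous_ciSup (fun A => bddAbove_looError H A s) fun h => ?_
    exact ((continuous_looError h.1 s).div_const _).lowerSemicontinuous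
  obtain ⟨A, -, hA⟩ := (hlsc.lowerSemicontinuousOn Set.univ).exists_isMinOn
    (Set.univ_nonempty) isCompact_univ
  exact ⟨A, fun B => hA (Set.mem_univ B)⟩

/-- Among all reorderings of a dataset and all learners there is a best pair. -/
lemma exists_min_transError_perm {H : Set (X → Bool)} (hH : H.Nonempty) {n : ℕ}
    (s : Fin (n + 1) → X) :
    ∃ (τ : Equiv.Perm (Fin (n + 1))) (A : RandLearner X),
      ∀ (τ' : Equiv.Perm (Fin (n + 1))) (B : RandLearner X),
        transError H A (s ∘ τ) ≤ transError H B (s ∘ τ') := by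
  choose A hA using fun τ : Equiv.Perm (Fin (n + 1)) => exists_min_transError hH (s ∘ τ)
  obtain ⟨τ, hτ⟩ := Finite.exists_min fun τ => transError H (A τ) (s ∘ τ)
  exact ⟨τ, A τ, fun τ' B => (hτ τ').trans (hA τ' B)⟩

/-- The labeling read off from a labeled sample: `true` exactly at the points that occur with the
label `true`. -/
noncomputable def readLabel {m : ℕ} (S : Fin m → X × Bool) (x : X) : Bool :=
  open Classical in decide (∃ i, S i = (x, true))

open Classical in
lemma readLabel_labeled (h : X → Bool) {m : ℕ} (s : Fin m → X) {x : X} (hx : ∃ i, s i = x) :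
    readLabel (labeled h s) x = h x := by
  obtain ⟨i, rfl⟩ := hx
  by_cases hi : h (s i) = true
  · rw [hi]
    exact decide_eq_true (p := ∃ j, labeled h s j = (s i, true)) ⟨i, by simp [labeled, hi]⟩
  · rw [Bool.not_eq_true] at hi
    rw [hi]
    refine decide_eq_false (p := ∃ j, labeled h s j = (s i, true)) ?_
    rintro ⟨j, hj⟩
    simp only [labeled, Prod.mk.injEq] at hj
    rw [hj.1, hi] at hj
    exact Bool.false_ne_true hj.2

/-- The multiset of the values of a finite sequence. -/
def values {n : ℕ} (s : Fin n → X) : Multiset X := Finset.univ.val.map s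

/-- A learner that knows, for every multiset of `n + 1` points, an enumeration `u` of it and a
learner `B` to be used on `u`. It repeats the label of a test point seen in training; otherwise
it treats the training points as the enumeration `u` of all the points with the test point left
out, and runs `B`. -/
noncomputable def patch (F : (n : ℕ) → Multiset X → (Fin (n + 1) → X) × RandLearner X) :
    RandLearner X := fun n S x => open Classical in
  if ∃ i, (S i).1 = x then (if readLabel S x = true then 1 else 0)
  else
    let u := (F n (x ::ₘ values fun i => (S i).1)).1
    let B := (F n (x ::ₘ values fun i => (S i).1)).2
    if hi : ∃ i, u i = x then B n (hi.choose.removeNth (labeled (readLabel S) u)) x else 0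

lemma exists_perm_of_values_eq {n : ℕ} {s t : Fin n → X} (h : values s = values t) :
    ∃ ρ : Equiv.Perm (Fin n), s = t ∘ ρ := by
  classical
  have hcard : ∀ x, Fintype.card {i // s i = x} = Fintype.card {i // t i = x} := by
    intro x
    have := congrArg (Multiset.count x) h
    simp only [values, Multiset.count_map, eq_comm (a := x)] at this
    rw [Fintype.card_subtype, Fintype.card_subtype]
    exact this
  refine ⟨Equiv.ofFiberEquiv fun x => Fintype.equivOfCardEq (hcard x), ?_⟩
  funext i
  exact (Equiv.ofFiberEquiv_map _ i).symm

lemma values_cons_removeNth {n : ℕ} (s : Fin (n + 1) → X) (i : Fin (n + 1)) :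
    s i ::ₘ values (fun j => s (i.succAbove j)) = values s := by
  unfold values
  rw [Fin.univ_succAbove n i]
  simp [Function.comp_def]

lemma looError_patch_le (F : (n : ℕ) → Multiset X → (Fin (n + 1) → X) × RandLearner X)
    (h : X → Bool) {n : ℕ} (s : Fin (n + 1) → X) (τ : Equiv.Perm (Fin (n + 1)))
    (hF : (F n (values s)).1 = s ∘ τ) :
    looError (patch F) h s ≤ looError (F n (values s)).2 h (s ∘ τ) := by
  classical
  unfold looError
  rw [← Equiv.sum_comp τ]
  refine Finset.sum_le_sum fun k _ => ?_
  have hlab : (τ k).removeNth (labeled h s) = labeled h (fun j => s ((τ k).succAbove j)) := rfl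
  by_cases hrep : ∃ j, (labeled h (fun j => s ((τ k).succAbove j)) j).1 = s (τ k)
  · have : patch F n ((τ k).removeNth (labeled h s)) (s (τ k))
        = if h (s (τ k)) = true then 1 else 0 := by
      rw [hlab, patch, if_pos hrep,
        readLabel_labeled h (fun j => s ((τ k).succAbove j)) hrep]
    rw [this]
    refine le_trans (le_of_eq ?_) (miss_nonneg _ _)
    unfold miss
    split_ifs <;> simp
  · have huniq : ∀ j, (s ∘ τ) j = s (τ k) → j = k := by
      intro j hj
      by_contra hne
      obtain ⟨l, hl⟩ := Fin.exists_succAbove_eq (fun e => hne (τ.injective e) : τ j ≠ τ k)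
      exact hrep ⟨l, (congrArg s hl).trans hj⟩
    have hval : (s (τ k) ::ₘ values fun j => (labeled h (fun j => s ((τ k).succAbove j)) j).1)
        = values s := values_cons_removeNth s (τ k)
    have hi : ∃ i, (F n (values s)).1 i = s (τ k) := ⟨k, by rw [hF]; rfl⟩
    have hchoose : hi.choose = k := huniq _ (by rw [← hF]; exact hi.choose_spec)
    have hlabels : hi.choose.removeNth (labeled (readLabel (labeled h
        (fun j => s ((τ k).succAbove j)))) (F n (values s)).1)
        = k.removeNth (labeled h (s ∘ τ)) := by
      rw [hchoose, hF]
      funext j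
      have hne : τ (k.succAbove j) ≠ τ k := fun e => Fin.succAbove_ne k j (τ.injective e)
      obtain ⟨l, hl⟩ := Fin.exists_succAbove_eq hne
      refine Prod.ext rfl (readLabel_labeled h _ ⟨l, congrArg s hl⟩)
    have : patch F n ((τ k).removeNth (labeled h s)) (s (τ k))
        = (F n (values s)).2 n (k.removeNth (labeled h (s ∘ τ))) ((s ∘ τ) k) := by
      rw [hlab, patch, if_neg hrep]
      simp only [hval]
      rw [dif_pos hi, hlabels]
      rfl
    rw [this]
    rfl

lemma transError_patch_le (H : Set (X → Bool))
    (F : (n : ℕ) → Multiset X → (Fin (n + 1) → X) × RandLearner X)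
    {n : ℕ} (s : Fin (n + 1) → X) (τ : Equiv.Perm (Fin (n + 1)))
    (hF : (F n (values s)).1 = s ∘ τ) :
    transError H (patch F) s ≤ transError H (F n (values s)).2 (s ∘ τ) := by
  refine transError_le _ _ (transError_nonneg _ _ _) fun h hh => ?_
  refine le_trans ?_ (looError_le_transError _ hh _)
  gcongr
  exact looError_patch_le F h s τ hF

/-- One-inclusion-graph learners exist for every nonempty class. The transductive problems of
datasets that are not reorderings of one another involve different inputs, so optimal solutions,
one for each multiset of points, patch together. -/
theorem exists_isOIG [Nonempty X] {H : Set (X → Bool)} (hH : H.Nonempty) :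
    ∃ A : RandLearner X, IsOIG H A := by
  classical
  have key : ∀ (n : ℕ) (K : Multiset X), ∃ P : (Fin (n + 1) → X) × RandLearner X,
      ∀ s : Fin (n + 1) → X, values s = K →
        (∃ τ : Equiv.Perm (Fin (n + 1)), P.1 = s ∘ τ) ∧
        ∀ B : RandLearner X, transError H P.2 P.1 ≤ transError H B s := by
    intro n K
    by_cases hK : ∃ s : Fin (n + 1) → X, values s = K
    · obtain ⟨s₀, rfl⟩ := hK
      obtain ⟨τ, A, hA⟩ := exists_min_transError_perm hH s₀
      refine ⟨(s₀ ∘ τ, A), fun s hs => ?_⟩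
      obtain ⟨ρ, hρ⟩ := exists_perm_of_values_eq hs
      constructor
      · refine ⟨τ.trans ρ.symm, ?_⟩
        funext i
        simp [hρ]
      · intro B
        rw [hρ]
        exact hA ρ B
    · exact ⟨(fun _ => Classical.arbitrary X, fun _ _ _ => 0), fun s hs => absurd ⟨s, hs⟩ hK⟩
  choose F hF using key
  refine ⟨patch F, fun B n s => ?_⟩
  obtain ⟨⟨τ, hτ⟩, hmin⟩ := hF n _ s rfl
  refine (transError_patch_le H F s τ hτ).trans ?_
  rw [← hτ]
  exact hmin B

/-! ### One-inclusion-graph learners on shattered datasets -/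

/-- If `A` has transductive error at most `1/2` on a shattered dataset without repetitions, then
its leave-one-out error is exactly `1/2` for every labeling, since that is its average over all
labelings. -/
lemma looError_eq_half {H : Set (X → Bool)} {A : RandLearner X} {n : ℕ} {s : Fin (n + 1) → X}
    (hs : Function.Injective s)
    (hsh : ∀ g : X → Bool, ∃ h ∈ H, ∀ i, h (s i) = g (s i))
    (hA : transError H A s ≤ 1 / 2) (h : X → Bool) :
    looError A h s = ((n : ℝ) + 1) / 2 := by
  classical
  let f : (Fin (n + 1) → Bool) → Fin (n + 1) → ℝ := fun y i =>
    miss (A n (i.removeNth fun j => (s j, y j)) (s i)) (y i)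
  have hf : ∀ g : X → Bool, looError A g s = ∑ i, f (g ∘ s) i := fun g => rfl
  have hle : ∀ y : Fin (n + 1) → Bool, ∑ i, f y i ≤ ((n : ℝ) + 1) / 2 := by
    intro y
    obtain ⟨g, hg, hgs⟩ := hsh (Function.extend s y fun _ => false)
    have hy : g ∘ s = y := by
      funext i
      rw [Function.comp_apply, hgs, hs.extend_apply]
    have h1 := (looError_le_transError A hg s).trans hA
    rw [div_le_iff₀ (by positivity), hf, hy] at h1
    linarith
  have hsum : ∑ y, ∑ i, f y i = ∑ _y : Fin (n + 1) → Bool, ((n : ℝ) + 1) / 2 := by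
    have hflip : ∀ i, ∑ y, f y i = (Fintype.card (Fin (n + 1) → Bool) : ℝ) / 2 := by
      intro i
      -- flipping the label at `i` pairs up the labelings; within a pair the training data agree
      let e : (Fin (n + 1) → Bool) → (Fin (n + 1) → Bool) := fun y => Function.update y i (!y i)
      have he : Function.Involutive e := by
        intro y
        simp [e]
      have h1 : ∑ y, f (e y) i = ∑ y, f y i := Equiv.sum_comp he.toPerm fun y => f y i
      have h2 : ∀ y, f y i + f (e y) i = 1 := by
        intro y
        have : (i.removeNth fun j => (s j, e y j)) = i.removeNth fun j => (s j, y j) := by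
          funext j
          simp [Fin.removeNth, e, Fin.succAbove_ne]
        simp only [f, this]
        simp only [e, Function.update_self]
        exact miss_add_miss_not _ _
      have h3 : ∑ y, f y i + ∑ y, f (e y) i = Fintype.card (Fin (n + 1) → Bool) := by
        rw [← Finset.sum_add_distrib, Finset.sum_congr rfl fun y _ => h2 y]
        simp
      linarith
    rw [Finset.sum_comm, Finset.sum_congr rfl fun i _ => hflip i]
    simp only [Finset.sum_const, Finset.card_univ, nsmul_eq_mul, Fintype.card_fin]
    push_cast
    ring
  rw [hf]
  exact (Finset.sum_eq_sum_iff_of_le fun y _ => hle y).1 hsum _ (Finset.mem_univ _)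

lemma IsOIG.transError_le_half {H : Set (X → Bool)} {A : RandLearner X} (hA : IsOIG H A) {n : ℕ}
    (s : Fin (n + 1) → X) : transError H A s ≤ 1 / 2 := by
  refine (hA (fun _ _ _ => ⟨1 / 2, by norm_num, by norm_num⟩) n s).trans ?_
  refine transError_le _ _ (by norm_num) fun h _ => ?_
  rw [div_le_iff₀ (by positivity)]
  refine le_of_eq ?_
  have : ∀ y, miss ⟨1 / 2, by norm_num, by norm_num⟩ y = 1 / 2 := by
    intro y
    cases y <;> norm_num [miss]
  simp only [looError, this, Finset.sum_const, Finset.card_univ, Fintype.card_fin, nsmul_eq_mul]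
  push_cast
  ring

end OIG


/-! ### Independent samples from a discrete distribution -/

section Sampling

variable {X : Type} [MeasurableSpace X] [DiscreteMeasurableSpace X] [Countable X]

/-- The law of `m` independent draws from `D`. -/
noncomputable abbrev iid (D : ProbabilityMeasure X) (m : ℕ) : Measure (Fin m → X) :=
  Measure.pi fun _ => (D : Measure X)

lemma integral_indicator_const_one {Ω : Type} [MeasurableSpace Ω] [DiscreteMeasurableSpace Ω]
    (μ : Measure Ω) (T : Set Ω) : ∫ x, T.indicator (fun _ => (1 : ℝ)) x ∂μ = μ.real T :=
  integral_indicator_one MeasurableSet.of_discrete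

/-- The expected error after `k` examples is the expected leave-one-out error on `k + 1` points,
as each of them is equally likely to play the role of the test point. -/
lemma expectedError_eq_looError (A : RandLearner X) (h : X → Bool) (D : ProbabilityMeasure X)
    (k : ℕ) :
    expectedError A h D k = expect D (k + 1) fun u => looError A h u / ((k : ℝ) + 1) := by
  have hi : ∀ i : Fin (k + 1), expectedError A h D k =
      ∫ u, miss (A k (i.removeNth (labeled h u)) (u i)) (h (u i)) ∂(iid D (k + 1)) := by
    intro i
    have hmp := measurePreserving_piFinSuccAbove (fun _ : Fin (k + 1) => (D : Measure X)) i
    have := hmp.integral_comp'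
      (g := fun q : X × (Fin k → X) => miss (A k (labeled h q.2) q.1) (h q.1))
    refine Eq.trans ?_ this.symm
    rw [integral_prod_symm]
    · rfl
    · refine integrable_of_abs_le _ _ 1 fun q => ?_
      rw [abs_of_nonneg (miss_nonneg _ _)]
      exact miss_le_one _ _
  unfold expect looError
  rw [integral_div, integral_finsetSum]
  · rw [← Finset.sum_congr rfl fun i _ => hi i]
    simp only [Finset.sum_const, Finset.card_univ, Fintype.card_fin, nsmul_eq_mul]
    push_cast
    field_simp
  · intro i _
    refine integrable_of_abs_le _ _ 1 fun q => ?_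
    rw [abs_of_nonneg (miss_nonneg _ _)]
    exact miss_le_one _ _

lemma iid_eq_le (D : ProbabilityMeasure X) {δ : ENNReal} (hδ : ∀ x, (D : Measure X) {x} ≤ δ)
    {m : ℕ} {i j : Fin m} (hij : i ≠ j) : iid D m {u | u i = u j} ≤ δ := by
  obtain _ | n := m
  · exact i.elim0
  obtain ⟨l, rfl⟩ := Fin.exists_succAbove_eq hij.symm
  have hmp := measurePreserving_piFinSuccAbove (fun _ : Fin (n + 1) => (D : Measure X)) i
  have h1 := hmp.measure_preimage_equiv {q : X × (Fin n → X) | q.1 = q.2 l}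
  have h2 : iid D (n + 1) {u | u i = u (i.succAbove l)}
      = ((D : Measure X).prod (iid D n)) {q : X × (Fin n → X) | q.1 = q.2 l} := h1
  rw [h2, Measure.prod_apply_symm (MeasurableSet.of_discrete)]
  calc _ = ∫⁻ v, (D : Measure X) {v l} ∂(iid D n) := rfl
    _ ≤ ∫⁻ _v, δ ∂(iid D n) := lintegral_mono fun v => hδ _
    _ = δ := by simp

lemma iid_not_injective_le (D : ProbabilityMeasure X) {δ : ℝ} (hδ0 : 0 ≤ δ)
    (hδ : ∀ x, (D : Measure X).real {x} ≤ δ) (m : ℕ) :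
    (iid D m).real {u | ¬ Function.Injective u} ≤ (m : ℝ) ^ 2 * δ := by
  have hδ' : ∀ x, (D : Measure X) {x} ≤ ENNReal.ofReal δ := fun x => by
    rw [← ofReal_measureReal]
    exact ENNReal.ofReal_le_ofReal (hδ x)
  have hsub : {u : Fin m → X | ¬ Function.Injective u} ⊆
      ⋃ q ∈ (Finset.univ.filter fun q : Fin m × Fin m => q.1 ≠ q.2),
        {u : Fin m → X | u q.1 = u q.2} := by
    intro u hu
    simp only [Set.mem_ofPred_eq, Function.Injective, not_forall] at hu
    obtain ⟨i, j, h, hne⟩ := hu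
    simp only [Set.mem_iUnion]
    exact ⟨(i, j), by simpa using hne, h⟩
  calc (iid D m).real {u | ¬ Function.Injective u} ≤ _ := measureReal_mono hsub (measure_ne_top _ _)
    _ ≤ ∑ q ∈ (Finset.univ.filter fun q : Fin m × Fin m => q.1 ≠ q.2),
        (iid D m).real {u : Fin m → X | u q.1 = u q.2} := measureReal_biUnion_finset_le _ _
    _ ≤ ∑ q ∈ (Finset.univ.filter fun q : Fin m × Fin m => q.1 ≠ q.2), δ := by
        refine Finset.sum_le_sum fun q hq => ?_
        exact ENNReal.toReal_le_of_le_ofReal hδ0 (iid_eq_le D hδ' (Finset.mem_filter.1 hq).2)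
    _ ≤ ∑ _q : Fin m × Fin m, δ :=
        Finset.sum_le_sum_of_subset_of_nonneg (Finset.filter_subset _ _) fun _ _ _ => hδ0
    _ = (m : ℝ) ^ 2 * δ := by
        simp only [Finset.sum_const, Finset.card_univ, Fintype.card_prod, Fintype.card_fin,
          nsmul_eq_mul]
        push_cast
        ring

omit [Countable X] in
lemma iid_forall_notMem (D : ProbabilityMeasure X) (T : Set X) (m : ℕ) :
    (iid D m).real {u | ∀ i, u i ∉ T} = (1 - (D : Measure X).real T) ^ m := by
  have : {u : Fin m → X | ∀ i, u i ∉ T} = Set.univ.pi fun _ => Tᶜ := by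
    ext u
    simp
  rw [this, measureReal_def, Measure.pi_pi, Finset.prod_const, Finset.card_univ,
    Fintype.card_fin, ENNReal.toReal_pow, ← measureReal_def,
    probReal_compl_eq_one_sub MeasurableSet.of_discrete]

lemma expect_sum_indicator (D : ProbabilityMeasure X) (T : Set X) (m : ℕ) :
    expect D m (fun s => ∑ i, T.indicator (fun _ => (1 : ℝ)) (s i))
      = m * (D : Measure X).real T := by
  unfold expect
  rw [integral_finsetSum]
  · have : ∀ i : Fin m, ∫ s, T.indicator (fun _ => (1 : ℝ)) (s i) ∂(iid D m)
        = (D : Measure X).real T := by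
      intro i
      rw [integral_comp_eval (μ := fun _ : Fin m => (D : Measure X))
        (Measurable.of_discrete.aestronglyMeasurable)]
      exact integral_indicator_const_one _ _
    rw [Finset.sum_congr rfl fun i _ => this i]
    simp
  · intro i _
    refine integrable_of_abs_le _ _ 1 fun s => ?_
    by_cases h : s i ∈ T <;> simp [h]

/-- A birthday bound for arbitrary distributions. If all points of `T` have mass at least `a`, an
injective sample must avoid in its second half the points of `T` hit in its first half; these
have mass at least `a` times the number of hits, and the resulting exponential moment factors over
the independent draws. -/
lemma iid_injective_le_of_atoms (D : ProbabilityMeasure X) (T : Finset X) {a : ℝ}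
    (ha : ∀ x ∈ T, a ≤ (D : Measure X).real {x}) (m : ℕ) :
    (iid D m).real {u | Function.Injective u}
      ≤ Real.exp (-((m / 2 : ℕ) * (D : Measure X).real T
          * (1 - Real.exp (-((m / 2 : ℕ) * a))))) := by
  classical
  set l := m / 2 with hl
  set p : Fin m → Prop := fun i => (i : ℕ) < l with hp
  set μ₁ : Measure ({i // p i} → X) := Measure.pi fun _ => (D : Measure X) with hμ₁
  set μ₂ : Measure ({i // ¬ p i} → X) := Measure.pi fun _ => (D : Measure X) with hμ₂
  have hcard1 : Fintype.card {i // p i} = l := by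
    rw [Fintype.card_subtype]
    have : (Finset.univ.filter p) = Finset.univ.filter fun i : Fin m => (i : ℕ) < l := rfl
    rw [this, Fin.card_filter_val_lt]
    omega
  have hcard2 : l ≤ Fintype.card {i // ¬ p i} := by
    rw [Fintype.card_subtype_compl, hcard1, Fintype.card_fin]
    omega
  let hit : ({i // p i} → X) → Finset X := fun u => (Finset.univ.image u) ∩ T
  let F : ({i // p i} → X) × ({i // ¬ p i} → X) → ℝ := fun q =>
    (if Function.Injective q.1 then 1 else 0) *
      ∏ j, ((hit q.1 : Set X)ᶜ).indicator (fun _ => (1 : ℝ)) (q.2 j)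
  let g : X → ℝ := fun x => if x ∈ T then Real.exp (-(l * a)) else 1
  have hF0 : ∀ q, 0 ≤ F q := fun q => by
    refine mul_nonneg (by split_ifs <;> norm_num) (Finset.prod_nonneg fun j _ => ?_)
    exact Set.indicator_nonneg (fun _ _ => zero_le_one) _
  have hF1 : ∀ q, F q ≤ 1 := fun q => by
    refine mul_le_one₀ (by split_ifs <;> norm_num) (Finset.prod_nonneg fun j _ => ?_)
      (Finset.prod_le_one (fun j _ => ?_) fun j _ => ?_)
    · exact Set.indicator_nonneg (fun _ _ => zero_le_one) _
    · exact Set.indicator_nonneg (fun _ _ => zero_le_one) _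
    · exact Set.indicator_le_self' (fun _ _ => zero_le_one) _
  have hmp := measurePreserving_piEquivPiSubtypeProd (fun _ : Fin m => (D : Measure X)) p
  have hpt : ∀ u : {i // p i} → X, ∫ v, F (u, v) ∂μ₂ ≤ ∏ i, g (u i) := by
    intro u
    have hg : 0 ≤ ∏ i, g (u i) := Finset.prod_nonneg fun i _ => by
      simp only [g]; split_ifs <;> positivity
    simp only [F]
    by_cases hu : Function.Injective u
    · simp only [if_pos hu, one_mul]
      rw [hμ₂, integral_fintype_prod_eq_pow,
        integral_indicator_const_one,
        probReal_compl_eq_one_sub MeasurableSet.of_discrete]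
      set k := (Finset.univ.filter fun i => u i ∈ T).card with hk
      have hhit : (hit u).card = k := by
        have : hit u = (Finset.univ.filter fun i => u i ∈ T).image u := by
          ext x
          simp only [hit, Finset.mem_inter, Finset.mem_image, Finset.mem_filter, Finset.mem_univ,
            true_and]
          constructor
          · rintro ⟨⟨i, rfl⟩, hi⟩
            exact ⟨i, hi, rfl⟩
          · rintro ⟨i, hi, rfl⟩
            exact ⟨⟨i, rfl⟩, hi⟩
        rw [this, Finset.card_image_of_injective _ hu]
      have hmass : k * a ≤ (D : Measure X).real (hit u) := by
        rw [← sum_measureReal_singleton, ← hhit, ← nsmul_eq_mul]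
        exact Finset.card_nsmul_le_sum _ _ _ fun x hx => ha x (Finset.mem_inter.1 hx).2
      have hle1 : (D : Measure X).real (hit u) ≤ 1 := measureReal_le_one
      have hprod : ∏ i, g (u i) = Real.exp (-(l * a)) ^ k := by
        simp only [g]
        rw [Finset.prod_ite]
        simp [hk]
      rw [hprod, ← Real.exp_nat_mul]
      calc (1 - (D : Measure X).real (hit u)) ^ Fintype.card {i // ¬ p i}
          ≤ (1 - (D : Measure X).real (hit u)) ^ l :=
            pow_le_pow_of_le_one (by linarith) (sub_le_self _ measureReal_nonneg) hcard2
        _ ≤ (Real.exp (-(D : Measure X).real (hit u))) ^ l := by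
            refine pow_le_pow_left₀ (by linarith) ?_ _
            linarith [Real.add_one_le_exp (-(D : Measure X).real (hit u))]
        _ = Real.exp (l * (-(D : Measure X).real (hit u))) := by rw [← Real.exp_nat_mul]
        _ ≤ Real.exp (k * -(l * a)) := by
            refine Real.exp_le_exp.2 ?_
            have := mul_le_mul_of_nonneg_left hmass (Nat.cast_nonneg (α := ℝ) l)
            linarith
    · simpa only [if_neg hu, zero_mul, integral_zero] using hg
  have hgint : ∫ x, g x ∂(D : Measure X)
      = 1 - (D : Measure X).real T * (1 - Real.exp (-(l * a))) := by
    have : g = fun x => 1 - (T : Set X).indicator (fun _ => (1 : ℝ)) x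
        * (1 - Real.exp (-(l * a))) := by
      funext x
      by_cases hx : x ∈ T <;> simp [g, hx]
    rw [this, integral_sub (integrable_const _), integral_mul_const]
    · rw [integral_indicator_const_one]
      simp
    · refine (integrable_of_abs_le _ _ 1 fun x => ?_).mul_const _
      by_cases hx : x ∈ T <;> simp [hx]
  have hgint0 : 0 ≤ ∫ x, g x ∂(D : Measure X) := integral_nonneg fun x => by
    simp only [g]; split_ifs <;> positivity
  calc (iid D m).real {u | Function.Injective u}
      = ∫ s, {u : Fin m → X | Function.Injective u}.indicator (fun _ => (1 : ℝ)) s ∂(iid D m) :=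
        (integral_indicator_const_one _ _).symm
    _ ≤ ∫ s, F (MeasurableEquiv.piEquivPiSubtypeProd (fun _ => X) p s) ∂(iid D m) := by
        refine integral_mono ?_ ?_ fun s => ?_
        · refine integrable_of_abs_le _ _ 1 fun s => ?_
          by_cases hs : Function.Injective s <;> simp [hs]
        · refine integrable_of_abs_le _ _ 1 fun s => ?_
          rw [abs_of_nonneg (hF0 _)]
          exact hF1 _
        · by_cases hs : Function.Injective s
          · have h1 : Function.Injective
                (MeasurableEquiv.piEquivPiSubtypeProd (fun _ => X) p s).1 :=
              fun i j hij => Subtype.ext (hs hij)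
            simp only [F, if_pos h1, one_mul]
            rw [Set.indicator_of_mem (by exact hs), Finset.prod_eq_one]
            intro j _
            rw [Set.indicator_of_mem]
            simp only [hit, Set.mem_compl_iff, Finset.mem_coe, Finset.mem_inter, Finset.mem_image,
              Finset.mem_univ, true_and, not_and]
            rintro ⟨i, hi⟩
            exact absurd (hs hi) fun e => j.2 (e ▸ i.2)
          · rw [Set.indicator_of_notMem (by exact hs)]
            exact hF0 _
    _ = ∫ q, F q ∂(μ₁.prod μ₂) := hmp.integral_comp' F
    _ = ∫ u, ∫ v, F (u, v) ∂μ₂ ∂μ₁ := by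
        refine integral_prod _ (integrable_of_abs_le _ _ 1 fun q => ?_)
        rw [abs_of_nonneg (hF0 _)]
        exact hF1 _
    _ ≤ ∫ u, ∏ i, g (u i) ∂μ₁ := by
        refine integral_mono_of_nonneg (ae_of_all _ fun u => integral_nonneg fun v => hF0 _) ?_
          (ae_of_all _ hpt)
        refine Integrable.fintype_prod (f := fun _ => g) fun i => ?_
        refine integrable_of_abs_le _ _ (max (Real.exp (-(l * a))) 1) fun x => ?_
        simp only [g]
        split_ifs <;> simp
    _ = (∫ x, g x ∂(D : Measure X)) ^ l := by rw [hμ₁, integral_fintype_prod_eq_pow, hcard1]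
    _ ≤ (Real.exp (-((D : Measure X).real T * (1 - Real.exp (-(l * a)))))) ^ l := by
        refine pow_le_pow_left₀ hgint0 ?_ _
        rw [hgint]
        linarith [Real.add_one_le_exp (-((D : Measure X).real T * (1 - Real.exp (-(l * a)))))]
    _ = _ := by
        rw [← Real.exp_nat_mul]
        congr 1
        ring

/-- The birthday bound for a set `T` of at most `N` points and mass `p`: the points of `T` of mass
at least `p / (2 N)` carry mass at least `p / 2`. -/
lemma iid_injective_le (D : ProbabilityMeasure X) (T : Finset X) {N : ℕ} (hN : 0 < N)
    (hT : T.card ≤ N) (m : ℕ) :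
    (iid D m).real {u | Function.Injective u}
      ≤ Real.exp (-((m / 2 : ℕ) * ((D : Measure X).real T / 2)
          * (1 - Real.exp (-((m / 2 : ℕ) * ((D : Measure X).real T / (2 * N))))))) := by
  classical
  set p := (D : Measure X).real T with hp
  have hp0 : 0 ≤ p := measureReal_nonneg
  have hN' : (0 : ℝ) < N := by exact_mod_cast hN
  set T' := T.filter fun x => p / (2 * N) ≤ (D : Measure X).real {x} with hT'
  refine (iid_injective_le_of_atoms D T' (a := p / (2 * N))
    (fun x hx => (Finset.mem_filter.1 hx).2) m).trans (Real.exp_le_exp.2 (neg_le_neg ?_))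
  have hhalf : p / 2 ≤ (D : Measure X).real T' := by
    have h1 : p = ∑ x ∈ T, (D : Measure X).real {x} := (sum_measureReal_singleton T).symm
    rw [← Finset.sum_filter_add_sum_filter_not T
      fun x => p / (2 * N) ≤ (D : Measure X).real {x}] at h1
    have h2 : ∑ x ∈ T with ¬ p / (2 * N) ≤ (D : Measure X).real {x},
        (D : Measure X).real {x} ≤ p / 2 := by
      calc _ ≤ ∑ x ∈ T with ¬ p / (2 * N) ≤ (D : Measure X).real {x}, p / (2 * N) :=
            Finset.sum_le_sum fun x hx => (not_le.1 (Finset.mem_filter.1 hx).2).le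
        _ ≤ N * (p / (2 * N)) := by
            rw [Finset.sum_const, nsmul_eq_mul]
            gcongr
            exact (Finset.card_filter_le _ _).trans hT
        _ = p / 2 := by field_simp
    rw [← sum_measureReal_singleton T', hT']
    linarith
  have hexp : 0 ≤ 1 - Real.exp (-((m / 2 : ℕ) * (p / (2 * N)))) := by
    have : Real.exp (-((m / 2 : ℕ) * (p / (2 * N)))) ≤ 1 :=
      Real.exp_le_one_iff.2 (neg_nonpos.2 (by positivity))
    linarith
  gcongr

end Sampling


/-! ### The error of the majority learner -/

section Majority

variable {X : Type}

lemma le_two_mul_sum_of_majority_ne (h : X → Bool) (b : Bool) {m : ℕ} (s : Fin m → X) (x : X)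
    (hv : majority X m (labeled h s) x ≠ b) :
    (m : ℝ) ≤ 2 * ∑ i, {x | h x ≠ b}.indicator (fun _ => (1 : ℝ)) (s i) := by
  classical
  have hsum : ∑ i, {x | h x ≠ b}.indicator (fun _ => (1 : ℝ)) (s i)
      = ((Finset.univ.filter fun i => h (s i) ≠ b).card : ℝ) := by
    rw [← Finset.sum_boole]
    exact Finset.sum_congr rfl fun i _ => by by_cases hi : h (s i) = b <;> simp [hi]
  rw [hsum]
  have hcard := Finset.card_filter_add_card_filter_not (s := (Finset.univ : Finset (Fin m)))
    fun i => h (s i) = true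
  rw [Finset.card_univ, Fintype.card_fin] at hcard
  cases b
  · have hv' : majority X m (labeled h s) x = true := by simpa using hv
    have h1 : m ≤ 2 * (Finset.univ.filter fun i => h (s i) = true).card := of_decide_eq_true hv'
    have h2 : (Finset.univ.filter fun i => h (s i) ≠ false)
        = Finset.univ.filter fun i => h (s i) = true := by simp
    rw [h2]
    exact_mod_cast h1
  · have hv' : majority X m (labeled h s) x = false := by simpa using hv
    have h1 : ¬ m ≤ 2 * (Finset.univ.filter fun i => h (s i) = true).card :=
      of_decide_eq_false hv'
    have h2 : m ≤ 2 * (Finset.univ.filter fun i => h (s i) ≠ true).card := by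
      change _ + (Finset.univ.filter fun i => h (s i) ≠ true).card = m at hcard
      omega
    exact_mod_cast h2

variable [MeasurableSpace X] [DiscreteMeasurableSpace X] [Countable X]

/-- If the label `b` is wrong with probability `p ≤ 1/2`, then by Markov's inequality the training
majority differs from `b` with probability at most `2 p`, and the error is `p` or `1 - p`. -/
lemma expectedError_majority_le_aux (h : X → Bool) (b : Bool) (D : ProbabilityMeasure X) {m : ℕ}
    (hm : 0 < m) (hp : (D : Measure X).real {x | h x ≠ b} ≤ 1 / 2) :
    expectedError (majority X).toRand h D m ≤ 3 * (D : Measure X).real {x | h x ≠ b}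
      - 4 * (D : Measure X).real {x | h x ≠ b} ^ 2 := by
  set p := (D : Measure X).real {x | h x ≠ b} with hpdef
  have hm' : (0 : ℝ) < m := by exact_mod_cast hm
  have hcompl : (D : Measure X).real {x | h x = b} = 1 - p := by
    rw [hpdef, ← probReal_compl_eq_one_sub MeasurableSet.of_discrete]
    congr 1
    ext x
    simp
  let K : (Fin m → X) → ℝ := fun s => ∑ i, {x | h x ≠ b}.indicator (fun _ => (1 : ℝ)) (s i)
  have hK0 : ∀ s, 0 ≤ K s := fun s =>
    Finset.sum_nonneg fun i _ => Set.indicator_nonneg (fun _ _ => zero_le_one) _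
  have hK1 : ∀ s, K s ≤ m := fun s => by
    calc K s ≤ ∑ _i : Fin m, (1 : ℝ) :=
          Finset.sum_le_sum fun i _ => Set.indicator_le_self' (fun _ _ => zero_le_one) _
      _ = m := by simp
  have hKint : Integrable K (iid D m) := integrable_of_abs_le _ _ m fun s => by
    rw [abs_of_nonneg (hK0 s)]
    exact hK1 s
  have hinner : ∀ s : Fin m → X,
      ∫ x, miss ((majority X).toRand m (labeled h s) x) (h x) ∂(D : Measure X)
        ≤ p + (1 - 2 * p) * (2 / m) * K s := by
    intro s
    obtain ⟨v, hv⟩ : ∃ v, ∀ x, majority X m (labeled h s) x = v := ⟨_, fun _ => rfl⟩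
    have h1 : ∫ x, miss ((majority X).toRand m (labeled h s) x) (h x) ∂(D : Measure X)
        = (D : Measure X).real {x | h x ≠ v} := by
      rw [← integral_indicator_const_one]
      congr 1
      funext x
      rw [miss_toRand, hv]
      by_cases hx : h x = v
      · simp [hx]
      · simp [hx, Ne.symm hx]
    rw [h1]
    by_cases hvb : v = b
    · subst hvb
      have : 0 ≤ (1 - 2 * p) * (2 / m) * K s :=
        mul_nonneg (mul_nonneg (by linarith) (by positivity)) (hK0 s)
      linarith
    · have h2 : {x | h x ≠ v} = {x | h x = b} := by
        ext x
        simp only [Set.mem_ofPred_eq]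
        cases h x <;> cases v <;> cases b <;> simp_all
      obtain ⟨x⟩ : Nonempty X := ⟨s ⟨0, hm⟩⟩
      have h3 : (m : ℝ) ≤ 2 * K s := le_two_mul_sum_of_majority_ne h b s x (by rw [hv]; exact hvb)
      have h4 : 1 ≤ 2 / m * K s := by
        rw [div_mul_eq_mul_div, le_div_iff₀ hm']
        linarith
      have h5 := mul_le_mul_of_nonneg_left h4 (by linarith : 0 ≤ 1 - 2 * p)
      rw [h2, hcompl, mul_assoc]
      linarith
  have hint : Integrable (fun s => p + (1 - 2 * p) * (2 / m) * K s) (iid D m) :=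
    (integrable_const _).add (hKint.const_mul _)
  calc expectedError (majority X).toRand h D m
      ≤ ∫ s, (p + (1 - 2 * p) * (2 / m) * K s) ∂(iid D m) :=
        integral_mono_of_nonneg
          (ae_of_all _ fun s => integral_nonneg fun x => miss_nonneg _ _) hint
          (ae_of_all _ hinner)
    _ = p + (1 - 2 * p) * (2 / m) * (m * p) := by
        rw [integral_add (integrable_const _) (hKint.const_mul _), integral_const_mul]
        have : ∫ s, K s ∂(iid D m) = m * p := expect_sum_indicator D _ m
        rw [this]
        simp
    _ = 3 * p - 4 * p ^ 2 := by
        field_simp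
        ring

/-- The error of the majority learner is at most three times the mass of either label. The
absolute bound, away from `1`, is what lets a certifier succeed that detects large errors only
with constant probability. -/
lemma expectedError_majority_le (h : X → Bool) (b : Bool) (D : ProbabilityMeasure X) {m : ℕ}
    (hm : 0 < m) :
    expectedError (majority X).toRand h D m
      ≤ min (3 * (D : Measure X).real {x | h x ≠ b}) (9 / 16) := by
  set p := (D : Measure X).real {x | h x ≠ b} with hpdef
  rcases le_total p (1 / 2) with hp | hp
  · have h1 := expectedError_majority_le_aux h b D hm hp
    rw [← hpdef] at h1
    refine le_min ?_ ?_
    · nlinarith [sq_nonneg p]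
    · nlinarith [sq_nonneg (p - 3 / 8)]
  · have hq : (D : Measure X).real {x | h x ≠ !b} = 1 - p := by
      rw [hpdef, ← probReal_compl_eq_one_sub MeasurableSet.of_discrete]
      congr 1
      ext x
      simp
    have h1 := expectedError_majority_le_aux h (!b) D hm (by rw [hq]; linarith)
    rw [hq] at h1
    refine le_min ?_ ?_
    · nlinarith [sq_nonneg (1 - p)]
    · nlinarith [sq_nonneg (1 - p - 3 / 8)]

end Majority

/-! ### The class and the certifier -/

/-- The class of labelings of `ℕ × ℕ` that are constant except on at most `N` points of a single
row `{N} × ℕ`. -/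
def sparseClass : Set (ℕ × ℕ → Bool) :=
  {h | ∃ (b : Bool) (N : ℕ) (T : Finset (ℕ × ℕ)),
    (∀ x ∈ T, x.1 = N) ∧ T.card ≤ N ∧ ∀ x, x ∉ T → h x = b}

/-- The value certified for a sample without repetitions: up to a constant, `√N / m` with `N` the
largest row seen, since a set of at most `N` points with larger mass would cause repetitions. -/
noncomputable def certifiedValue {m : ℕ} (s : Fin m → ℕ × ℕ) : ℝ :=
  min 1 (100 * √((Finset.univ.sup fun i => (s i).1 : ℕ) + 1) / (m + 1))

lemma certifiedValue_mem {m : ℕ} (s : Fin m → ℕ × ℕ) : certifiedValue s ∈ unitInterval :=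
  ⟨le_min zero_le_one (by positivity), min_le_left _ _⟩

/-- The certifier for the majority learner: if a point is repeated, it certifies only the
trivial bound `1`. -/
noncomputable def birthdayCertifier : Certifier (ℕ × ℕ) := fun _ s =>
  open Classical in
  if Function.Injective s then ⟨certifiedValue s, certifiedValue_mem s⟩ else 1

lemma certifiedValue_le_birthdayCertifier {m : ℕ} (s : Fin m → ℕ × ℕ) :
    certifiedValue s ≤ birthdayCertifier m s := by
  unfold birthdayCertifier
  split_ifs
  · exact le_rfl
  · exact (certifiedValue_mem s).2

lemma le_certifiedValue {m N : ℕ} {s : Fin m → ℕ × ℕ} {i : Fin m} (hi : (s i).1 = N) :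
    min 1 (100 * √((N : ℝ) + 1) / (m + 1)) ≤ certifiedValue s := by
  have : N ≤ Finset.univ.sup fun i => (s i).1 := by
    rw [← hi]
    exact Finset.le_sup (f := fun i => (s i).1) (Finset.mem_univ i)
  unfold certifiedValue
  gcongr

lemma integrable_birthdayCertifier (D : ProbabilityMeasure (ℕ × ℕ)) (m : ℕ) :
    Integrable (fun s => (birthdayCertifier m s : ℝ)) (iid D m) :=
  integrable_of_abs_le _ _ 1 fun s => by
    rw [abs_of_nonneg (birthdayCertifier m s).2.1]
    exact (birthdayCertifier m s).2.2

lemma const_mul_measureReal_le_expect (D : ProbabilityMeasure (ℕ × ℕ)) {m : ℕ} {c : ℝ}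
    {E : Set (Fin m → ℕ × ℕ)} (hc : ∀ s ∈ E, c ≤ birthdayCertifier m s) :
    c * (iid D m).real E ≤ expect D m fun s => (birthdayCertifier m s : ℝ) := by
  rw [← integral_indicator_const_one, ← integral_const_mul]
  refine integral_mono ?_ (integrable_birthdayCertifier D m) fun s => ?_
  · refine (integrable_of_abs_le _ _ 1 fun s => ?_).const_mul _
    by_cases hs : s ∈ E <;> simp [hs]
  · by_cases hs : s ∈ E
    · simpa [hs] using hc s hs
    · simpa [hs] using (birthdayCertifier m s).2.1

lemma const_le_expect_birthdayCertifier (D : ProbabilityMeasure (ℕ × ℕ)) (m : ℕ) :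
    min 1 (100 / ((m : ℝ) + 1)) ≤ expect D m fun s => (birthdayCertifier m s : ℝ) := by
  have h := const_mul_measureReal_le_expect D (m := m) (E := Set.univ)
    (c := min 1 (100 / ((m : ℝ) + 1))) fun s _ => ?_
  · simpa using h
  · refine le_trans ?_ (certifiedValue_le_birthdayCertifier s)
    unfold certifiedValue
    gcongr
    have : 1 ≤ √(((Finset.univ.sup fun i => (s i).1 : ℕ) : ℝ) + 1) :=
      Real.one_le_sqrt.2 (by linarith [Nat.cast_nonneg (α := ℝ) (Finset.univ.sup fun i => (s i).1)])
    linarith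

lemma hit_le_expect_birthdayCertifier (D : ProbabilityMeasure (ℕ × ℕ)) (m : ℕ) {N : ℕ}
    {T : Finset (ℕ × ℕ)} (hT : ∀ x ∈ T, x.1 = N) :
    min 1 (100 * √((N : ℝ) + 1) / (m + 1)) * (1 - (1 - (D : Measure (ℕ × ℕ)).real T) ^ m)
      ≤ expect D m fun s => (birthdayCertifier m s : ℝ) := by
  rw [← iid_forall_notMem, ← probReal_compl_eq_one_sub MeasurableSet.of_discrete]
  refine const_mul_measureReal_le_expect D fun s hs => ?_
  simp only [Set.mem_compl_iff, Set.mem_ofPred_eq, not_forall, not_not] at hs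
  obtain ⟨i, hi⟩ := hs
  exact (le_certifiedValue (hT _ hi)).trans (certifiedValue_le_birthdayCertifier s)

lemma collision_le_expect_birthdayCertifier (D : ProbabilityMeasure (ℕ × ℕ)) (m : ℕ) :
    1 - (iid D m).real {s | Function.Injective s}
      ≤ expect D m fun s => (birthdayCertifier m s : ℝ) := by
  rw [← probReal_compl_eq_one_sub MeasurableSet.of_discrete,
    ← one_mul ((iid D m).real _)]
  refine const_mul_measureReal_le_expect D fun s hs => ?_
  have hs' : ¬ Function.Injective s := hs
  simp [birthdayCertifier, hs']

/-- The birthday bound in the regime `6 p > 100 √(N + 1) / (m + 1)`. -/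
lemma iid_injective_le_third (D : ProbabilityMeasure (ℕ × ℕ)) {m N : ℕ} {T : Finset (ℕ × ℕ)}
    (hN : 0 < N) (hT : T.card ≤ N) (hρ : 100 * √((N : ℝ) + 1) / (m + 1) < 1)
    (hp : 100 * √((N : ℝ) + 1) / (m + 1) < 6 * (D : Measure (ℕ × ℕ)).real T) :
    (iid D m).real {s | Function.Injective s} ≤ 1 / 3 := by
  refine (iid_injective_le D T hN hT m).trans ?_
  set p := (D : Measure (ℕ × ℕ)).real T
  set r := √((N : ℝ) + 1) with hr
  set l : ℝ := ((m / 2 : ℕ) : ℝ) with hl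
  have hN' : (1 : ℝ) ≤ N := by exact_mod_cast hN
  have hr2 : r ^ 2 = N + 1 := Real.sq_sqrt (by positivity)
  have hr1 : 1 ≤ r := Real.one_le_sqrt.2 (by linarith)
  have hm1 : (0 : ℝ) < (m : ℝ) + 1 := by positivity
  rw [div_lt_one hm1] at hρ
  rw [div_lt_iff₀ hm1] at hp
  have hl1 : (m : ℝ) ≤ 2 * l + 1 := by
    have : m ≤ 2 * (m / 2) + 1 := by omega
    rw [hl]
    exact_mod_cast this
  have hp0 : 0 ≤ p := measureReal_nonneg
  have hlp : 8 * r ≤ l * p := by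
    have h1 : 0.49 * ((m : ℝ) + 1) ≤ l := by linarith
    have h2 := mul_le_mul_of_nonneg_right h1 hp0
    nlinarith
  set u := l * (p / (2 * N)) with hu
  have hNu : 2 * (N * u) = l * p := by
    rw [hu]
    field_simp
  have hu0 : 0 < u := by
    have : 0 < N * u := by linarith
    exact pos_of_mul_pos_right this (by linarith)
  have hexp : Real.exp (-u) ≤ 1 / (1 + u) := by
    rw [Real.exp_neg, ← one_div]
    exact one_div_le_one_div_of_le (by linarith) (by linarith [Real.add_one_le_exp u])
  have h2 : 2 ≤ l * (p / 2) * (1 - Real.exp (-u)) := by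
    have h3 : l * (p / 2) = N * u := by linarith
    have h4 : u / (1 + u) ≤ 1 - Real.exp (-u) := by
      have : u / (1 + u) = 1 - 1 / (1 + u) := by field_simp; ring
      linarith
    have h5 : 2 ≤ N * u * (u / (1 + u)) := by
      rw [← mul_div_assoc, le_div_iff₀ (by linarith)]
      have h6 : 4 * r ≤ N * u := by linarith
      have h7 : 16 * r ^ 2 ≤ (N * u) ^ 2 := by
        have := pow_le_pow_left₀ (by linarith) h6 2
        linarith
      have h8 : 16 ≤ N * u * u := by
        have : N * 16 ≤ N * (N * u * u) := by nlinarith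
        exact le_of_mul_le_mul_left this (by linarith)
      nlinarith
    rw [h3]
    exact h5.trans (mul_le_mul_of_nonneg_left h4 (by linarith))
  calc Real.exp (-(l * (p / 2) * (1 - Real.exp (-u)))) ≤ Real.exp (-2) :=
        Real.exp_le_exp.2 (by linarith)
    _ ≤ 1 / 3 := by
        rw [Real.exp_neg, ← one_div]
        exact one_div_le_one_div_of_le (by norm_num) (by linarith [Real.add_one_le_exp (2 : ℝ)])

/-- The birthday certifier is sound for the majority learner. If the set `T` of minority points of
row `N` has mass `p`, then either `p = O(1/m)`, or `T` is hit with high probability, so that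
`√N / m` is certified, or `p` is so large that repetitions are likely. -/
theorem isSound_birthdayCertifier :
    IsSound sparseClass (majority (ℕ × ℕ)) birthdayCertifier := by
  intro D m
  refine errorRate_le _ _ _ (integral_nonneg fun s => (birthdayCertifier m s).2.1) ?_
  rintro h ⟨b, N, T, hrow, hcard, hb⟩
  have hA := const_le_expect_birthdayCertifier D m
  obtain rfl | hm := Nat.eq_zero_or_pos m
  · refine (expectedError_mem _ _ _ _).2.trans (le_trans ?_ hA)
    norm_num
  have hB := hit_le_expect_birthdayCertifier D m hrow
  have hC := collision_le_expect_birthdayCertifier D m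
  set e := expect D m fun s => (birthdayCertifier m s : ℝ)
  set p := (D : Measure (ℕ × ℕ)).real T with hp
  have hp0 : 0 ≤ p := measureReal_nonneg
  have hp1 : p ≤ 1 := measureReal_le_one
  have hsub : (D : Measure (ℕ × ℕ)).real {x | h x ≠ b} ≤ p := by
    refine measureReal_mono fun x hx => ?_
    by_contra hxT
    exact hx (hb x hxT)
  have herr := expectedError_majority_le h b D hm
  have herr1 : expectedError (majority (ℕ × ℕ)).toRand h D m ≤ 3 * p :=
    (herr.trans (min_le_left _ _)).trans (by linarith)
  have herr2 : expectedError (majority (ℕ × ℕ)).toRand h D m ≤ 9 / 16 :=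
    herr.trans (min_le_right _ _)
  have hm1 : (0 : ℝ) < (m : ℝ) + 1 := by positivity
  by_cases h1 : 3 * p ≤ 100 / ((m : ℝ) + 1)
  · exact (le_min (by linarith) (herr1.trans h1)).trans hA
  rw [not_le, div_lt_iff₀ hm1] at h1
  have hhit : 16 / 17 ≤ 1 - (1 - p) ^ m := by
    have hmr : (1 : ℝ) ≤ m := by exact_mod_cast hm
    have hpm : 16 ≤ m * p := by nlinarith
    have h2 : (1 - p) ^ m ≤ Real.exp (-16) := by
      calc (1 - p) ^ m ≤ (Real.exp (-p)) ^ m :=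
            pow_le_pow_left₀ (by linarith) (by linarith [Real.add_one_le_exp (-p)]) _
        _ = Real.exp (m * -p) := by rw [← Real.exp_nat_mul]
        _ ≤ Real.exp (-16) := Real.exp_le_exp.2 (by linarith)
    have h3 : Real.exp (-16) ≤ 1 / 17 := by
      rw [Real.exp_neg, ← one_div]
      exact one_div_le_one_div_of_le (by norm_num) (by linarith [Real.add_one_le_exp (16 : ℝ)])
    linarith
  set ρ := 100 * √((N : ℝ) + 1) / (m + 1) with hρ
  have hρ0 : 0 ≤ ρ := by positivity
  by_cases hρ1 : 1 ≤ ρ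
  · rw [min_eq_left hρ1] at hB
    linarith
  rw [not_le] at hρ1
  rw [min_eq_right hρ1.le] at hB
  by_cases h2 : 6 * p ≤ ρ
  · nlinarith
  rw [not_le] at h2
  have hN : 0 < N := by
    rcases Nat.eq_zero_or_pos N with rfl | hN
    · have : T = ∅ := Finset.card_eq_zero.1 (Nat.le_zero.1 hcard)
      simp [hp, this] at h2
      linarith
    · exact hN
  have := iid_injective_le_third D hN hcard hρ1 h2
  linarith


/-! ### The sparse class on a row -/

/-- The first `n` points of the row `{N} × ℕ`. -/
def row (N n : ℕ) : Finset (ℕ × ℕ) := {N} ×ˢ Finset.range n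

lemma fst_of_mem_row {N n : ℕ} {x : ℕ × ℕ} (hx : x ∈ row N n) : x.1 = N := by
  simpa using (Finset.mem_product.1 hx).1

lemma card_row (N n : ℕ) : (row N n).card = n := by simp [row]

lemma row_nonempty (N : ℕ) {n : ℕ} (hn : 0 < n) : (row N n).Nonempty :=
  Finset.card_pos.1 (by rwa [card_row])

lemma shatters_sparseClass {N : ℕ} {T : Finset (ℕ × ℕ)} (hT : ∀ x ∈ T, x.1 = N)
    (hcard : T.card ≤ N) : Shatters sparseClass T := by
  intro g
  refine ⟨fun x => decide (x ∈ T.filter fun x => g x = true),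
    ⟨false, N, T.filter fun x => g x = true, fun x hx => hT x (Finset.mem_filter.1 hx).1,
      (Finset.card_filter_le _ _).trans hcard, fun x hx => by simpa using hx⟩, fun x hx => ?_⟩
  cases hg : g x <;> simp [hg, hx]

lemma const_false_mem_sparseClass : (fun _ => false) ∈ sparseClass :=
  ⟨false, 0, ∅, by simp, by simp, by simp⟩

lemma minorityCount_sparseClass_le {h : ℕ × ℕ → Bool} (hh : h ∈ sparseClass) (N n : ℕ) :
    minorityCount h (row N n) ≤ N := by
  obtain ⟨b, N', T, hrow, hcard, hb⟩ := hh
  have key : ((row N n).filter fun x => h x = !b).card ≤ N := by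
    have hsub : ((row N n).filter fun x => h x = !b) ⊆ T := by
      intro x hx
      by_contra hxT
      have h1 := (Finset.mem_filter.1 hx).2
      rw [hb x hxT] at h1
      simp at h1
    rcases Finset.eq_empty_or_nonempty ((row N n).filter fun x => h x = !b) with h0 | ⟨x, hx⟩
    · simp [h0]
    · have : N' = N := (hrow x (hsub hx)).symm.trans (fst_of_mem_row (Finset.mem_filter.1 hx).1)
      exact (Finset.card_le_card hsub).trans (this ▸ hcard)
  cases b
  · exact (min_le_left _ _).trans key
  · exact (min_le_right _ _).trans key

/-! ### The uniform distribution -/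

section Uniform

variable {X : Type} [MeasurableSpace X] [DiscreteMeasurableSpace X] [Countable X]
  (Y : Finset X) (hY : Y.Nonempty)

omit [Countable X] in
lemma unif_real_singleton_le (x : X) :
    (unif Y hY : Measure X).real {x} ≤ 1 / (Y.card : ℝ) := by
  classical
  have h1 : (unif Y hY : Measure X) {x} = PMF.uniformOfFinset Y hY x :=
    PMF.toMeasure_apply_singleton _ _ MeasurableSet.of_discrete
  rw [measureReal_def, h1, PMF.uniformOfFinset_apply]
  split_ifs
  · simp
  · simp

omit [Countable X] in
lemma unif_real_compl : (unif Y hY : Measure X).real (Y : Set X)ᶜ = 0 := by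
  have h1 : (unif Y hY : Measure X) (Y : Set X)ᶜ = 0 := by
    refine (PMF.toMeasure_apply_eq_zero_iff _ MeasurableSet.of_discrete).2 ?_
    rw [PMF.support_uniformOfFinset]
    exact disjoint_compl_right
  rw [measureReal_def, h1, ENNReal.toReal_zero]

lemma unif_real_le (T : Finset X) :
    (unif Y hY : Measure X).real T ≤ T.card / (Y.card : ℝ) := by
  rw [← sum_measureReal_singleton]
  calc _ ≤ ∑ _x ∈ T, 1 / (Y.card : ℝ) :=
        Finset.sum_le_sum fun x _ => unif_real_singleton_le Y hY x
    _ = T.card / (Y.card : ℝ) := by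
        rw [Finset.sum_const, nsmul_eq_mul, mul_one_div]

omit [Countable X] in
lemma iid_unif_forall_mem (m : ℕ) : (iid (unif Y hY) m).real {s | ∀ i, s i ∈ Y} = 1 := by
  have := iid_forall_notMem (unif Y hY) (Y : Set X)ᶜ m
  rw [unif_real_compl] at this
  simpa using this

lemma iid_unif_not_forall_mem (m : ℕ) : (iid (unif Y hY) m).real {s | ∀ i, s i ∈ Y}ᶜ = 0 := by
  rw [probReal_compl_eq_one_sub MeasurableSet.of_discrete, iid_unif_forall_mem, sub_self]

lemma iid_unif_not_injective_le (m : ℕ) :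
    (iid (unif Y hY) m).real {s | ¬ Function.Injective s} ≤ (m : ℝ) ^ 2 / Y.card := by
  refine (iid_not_injective_le (unif Y hY) (by positivity)
    (fun x => unif_real_singleton_le Y hY x) m).trans (le_of_eq ?_)
  rw [mul_one_div]

/-! ### Lower bounds for one-inclusion-graph learners and for ERM -/

/-- An OIG learner has leave-one-out error `1/2` on every sample without repetitions, as long as
the class shatters the samples of that size. -/
lemma quarter_le_errorRate_of_isOIG {H : Set (X → Bool)} (hH : H.Nonempty) {A : RandLearner X}
    (hA : IsOIG H A) {k : ℕ} (hk : 2 * (k + 1) ^ 2 ≤ Y.card)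
    (hsh : ∀ T : Finset X, T ⊆ Y → T.card ≤ k + 1 → Shatters H T) :
    1 / 4 ≤ errorRate H A (unif Y hY) k := by
  classical
  obtain ⟨h, hh⟩ := hH
  refine le_trans ?_ (expectedError_le_errorRate A hh _ k)
  rw [expectedError_eq_looError]
  set μ := iid (unif Y hY) (k + 1)
  set G : Set (Fin (k + 1) → X) := {u | ∀ i, u i ∈ Y} \ {u | ¬ Function.Injective u} with hG
  have hYc : (0 : ℝ) < Y.card := by exact_mod_cast hY.card_pos
  have hGle : 1 / 2 ≤ μ.real G := by
    have h1 : μ.real {u | ∀ i, u i ∈ Y} ≤ μ.real G + μ.real {u | ¬ Function.Injective u} := by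
      refine (measureReal_mono (fun u hu => ?_) (measure_ne_top _ _)).trans
        (measureReal_union_le G _)
      by_cases hui : Function.Injective u
      · exact Or.inl ⟨hu, fun h => h hui⟩
      · exact Or.inr hui
    have h2 := iid_unif_not_injective_le Y hY (k + 1)
    have h3 : (((k + 1 : ℕ) : ℝ)) ^ 2 / Y.card ≤ 1 / 2 := by
      rw [div_le_iff₀ hYc]
      have : (2 : ℝ) * (k + 1) ^ 2 ≤ Y.card := by exact_mod_cast hk
      push_cast
      linarith
    rw [iid_unif_forall_mem] at h1
    linarith
  have hval : ∀ u ∈ G, looError A h u / ((k : ℝ) + 1) = 1 / 2 := by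
    rintro u ⟨hu, hinj⟩
    have hinj' : Function.Injective u := not_not.1 hinj
    rw [looError_eq_half hinj' (fun g => ?_) (hA.transError_le_half u)]
    · field_simp
    · obtain ⟨f, hf, hfg⟩ := hsh (Finset.univ.image u)
        (fun x hx => by
          obtain ⟨i, -, rfl⟩ := Finset.mem_image.1 hx
          exact hu i)
        (Finset.card_image_le.trans (by simp)) g
      exact ⟨f, hf, fun i => hfg _ (Finset.mem_image_of_mem _ (Finset.mem_univ i))⟩
  calc (1 : ℝ) / 4 ≤ 1 / 2 * μ.real G := by linarith
    _ = ∫ u, 1 / 2 * G.indicator (fun _ => (1 : ℝ)) u ∂μ := by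
        rw [integral_const_mul, integral_indicator_const_one]
    _ ≤ ∫ u, looError A h u / ((k : ℝ) + 1) ∂μ := by
        refine integral_mono ?_ ?_ fun u => ?_
        · refine (integrable_of_abs_le _ _ 1 fun u => ?_).const_mul _
          by_cases hu : u ∈ G <;> simp [hu]
        · refine integrable_of_abs_le _ _ 1 fun u => ?_
          rw [abs_of_nonneg (div_nonneg (looError_nonneg A h u) (by positivity))]
          exact div_le_one_of_le₀ (looError_le _ _ _) (by positivity)
        · by_cases hu : u ∈ G
          · simp only [Set.indicator_of_mem hu, mul_one, hval u hu, le_refl]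
          · simp only [Set.indicator_of_notMem hu, mul_zero]
            exact div_nonneg (looError_nonneg A h u) (by positivity)

omit [MeasurableSpace X] [DiscreteMeasurableSpace X] [Countable X] in
lemma empiricalError_nonneg (f : X → Bool) {m : ℕ} (S : Fin m → X × Bool) :
    0 ≤ empiricalError f S :=
  div_nonneg (Finset.sum_nonneg fun i _ => by split_ifs <;> norm_num) (Nat.cast_nonneg m)

omit [MeasurableSpace X] [DiscreteMeasurableSpace X] [Countable X] in
lemma exists_min_empiricalError {H : Set (X → Bool)} (hH : H.Nonempty) {m : ℕ}
    (S : Fin m → X × Bool) : ∃ f ∈ H, ∀ h ∈ H, empiricalError f S ≤ empiricalError h S := by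
  have hfin : ((fun f => empiricalError f S) '' H).Finite := by
    refine (Set.finite_range fun y : Fin m → Bool =>
      (∑ i, if y i = (S i).2 then (0 : ℝ) else 1) / m).subset ?_
    rintro _ ⟨f, -, rfl⟩
    exact ⟨fun i => f (S i).1, rfl⟩
  obtain ⟨_, ⟨f, hf, rfl⟩, hmin⟩ := Set.exists_min_image _ id hfin (hH.image _)
  exact ⟨f, hf, fun h hh => hmin _ ⟨h, hh, rfl⟩⟩

omit [MeasurableSpace X] [DiscreteMeasurableSpace X] [Countable X] in
/-- An ERM that prefers, whenever it may, the predictor that is `true` exactly off the training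
points. -/
lemma exists_isERM_true_off_sample {H : Set (X → Bool)} (hH : H.Nonempty) :
    ∃ A : Learner X, IsERM H A ∧ ∀ (m : ℕ) (s : Fin m → X) (f : X → Bool),
      (∀ x, f x = false ↔ ∃ i, s i = x) → f ∈ H → A m (labeled (fun _ => false) s) = f := by
  classical
  have key : ∀ (m : ℕ) (S : Fin m → X × Bool), ∃ g : X → Bool,
      (g ∈ H ∧ ∀ h ∈ H, empiricalError g S ≤ empiricalError h S) ∧
      ∀ (s : Fin m → X) (f : X → Bool), S = labeled (fun _ => false) s →
        (∀ x, f x = false ↔ ∃ i, s i = x) → f ∈ H → g = f := by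
    intro m S
    by_cases hS : ∃ (s : Fin m → X) (f : X → Bool), S = labeled (fun _ => false) s ∧
        (∀ x, f x = false ↔ ∃ i, s i = x) ∧ f ∈ H
    · obtain ⟨s, f, rfl, hf, hfH⟩ := hS
      refine ⟨f, ⟨hfH, fun h _ => ?_⟩, fun s' f' hs' hf' _ => ?_⟩
      · have : empiricalError f (labeled (fun _ => false) s) = 0 := by
          have h1 : ∀ i, f (s i) = false := fun i => (hf _).2 ⟨i, rfl⟩
          simp [empiricalError, labeled, h1]
        rw [this]
        exact empiricalError_nonneg _ _
      · have hss : s = s' := by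
          funext i
          exact congrArg Prod.fst (congrFun hs' i)
        subst hss
        funext x
        rw [Bool.eq_iff_iff, ← not_iff_not, Bool.not_eq_true, Bool.not_eq_true, hf, hf']
    · obtain ⟨g, hg, hmin⟩ := exists_min_empiricalError hH S
      exact ⟨g, ⟨hg, hmin⟩, fun s f h1 h2 h3 => absurd ⟨s, f, h1, h2, h3⟩ hS⟩
  choose A hA hA' using key
  exact ⟨A, hA, fun m s f hf hfH => hA' m _ s f rfl hf hfH⟩

/-- If the class contains the constant `false` and the complements of all small subsets of `Y`,
worst-case tie-breaking makes ERM fail off the sample. -/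
lemma quarter_le_ermErrorRate {H : Set (X → Bool)} (hH : (fun _ => false) ∈ H) {k : ℕ}
    (hk : 2 * k ≤ Y.card)
    (hcompl : ∀ (T : Finset X) (f : X → Bool), T ⊆ Y → T.card ≤ k →
      (∀ x, f x = false ↔ x ∈ T) → f ∈ H) :
    1 / 4 ≤ ermErrorRate H (unif Y hY) k := by
  classical
  obtain ⟨A, hA, hAf⟩ := exists_isERM_true_off_sample ⟨_, hH⟩
  refine le_trans ?_ (errorRate_le_ermErrorRate hA _ _)
  refine le_trans ?_ (expectedError_le_errorRate _ hH _ k)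
  set μ := iid (unif Y hY) k
  set G : Set (Fin k → X) := {s | ∀ i, s i ∈ Y} with hG
  have hYc : (0 : ℝ) < Y.card := by exact_mod_cast hY.card_pos
  have hmem : ∀ s : Fin k → X, ∫ x, miss (A.toRand k (labeled (fun _ => false) s) x) false
      ∂(unif Y hY : Measure X) ∈ unitInterval := fun s =>
    integral_mem_unitInterval _ _ (fun x => miss_nonneg _ _) (fun x => miss_le_one _ _)
  have hval : ∀ s ∈ G, 1 / 2 ≤ ∫ x, miss (A.toRand k (labeled (fun _ => false) s) x) false
      ∂(unif Y hY : Measure X) := by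
    intro s hs
    set T := Finset.univ.image s with hT
    have hTcard : T.card ≤ k := Finset.card_image_le.trans (by simp)
    let f : X → Bool := fun x => decide (x ∉ T)
    have hf : ∀ x, f x = false ↔ x ∈ T := fun x => by simp [f]
    have hAs : A k (labeled (fun _ => false) s) = f := by
      refine hAf k s f (fun x => ?_) (hcompl T f (fun x hx => ?_) hTcard hf)
      · rw [hf, hT]
        simp
      · obtain ⟨i, -, rfl⟩ := Finset.mem_image.1 hx
        exact hs i
    have h1 : (fun x => miss (A.toRand k (labeled (fun _ => false) s) x) false)
        = ((T : Set X)ᶜ).indicator fun _ => (1 : ℝ) := by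
      funext x
      rw [miss_toRand, hAs]
      by_cases hx : x ∈ T <;> simp [f, hx]
    rw [h1, integral_indicator_const_one, probReal_compl_eq_one_sub MeasurableSet.of_discrete]
    have h2 := unif_real_le Y hY T
    have h3 : (T.card : ℝ) / Y.card ≤ 1 / 2 := by
      rw [div_le_iff₀ hYc]
      have h4 : (2 : ℝ) * T.card ≤ Y.card := by exact_mod_cast (by omega)
      linarith
    linarith
  calc (1 : ℝ) / 4 ≤ 1 / 2 * μ.real G := by
        rw [iid_unif_forall_mem]
        norm_num
    _ = ∫ s, 1 / 2 * G.indicator (fun _ => (1 : ℝ)) s ∂μ := by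
        rw [integral_const_mul, integral_indicator_const_one]
    _ ≤ expectedError A.toRand (fun _ => false) (unif Y hY) k := by
        refine integral_mono ?_ ?_ fun s => ?_
        · refine (integrable_of_abs_le _ _ 1 fun s => ?_).const_mul _
          by_cases hs : s ∈ G <;> simp [hs]
        · refine integrable_of_abs_le _ _ 1 fun s => ?_
          rw [abs_of_nonneg (hmem s).1]
          exact (hmem s).2
        · by_cases hs : s ∈ G
          · simpa [hs] using hval s hs
          · simpa [hs] using (hmem s).1

end Uniform

/-! ### The certified rate on a long row -/

/-- On a row that is long compared with `m²`, repetitions are rare and the certified rate is of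
order `√N / m`. -/
lemma expect_birthdayCertifier_unif_le {N n : ℕ} (hn : 0 < n) (m : ℕ) :
    (expect (unif (row N n) (row_nonempty N hn)) m fun s => (birthdayCertifier m s : ℝ))
      ≤ (m : ℝ) ^ 2 / n + 100 * √((N : ℝ) + 1) / (m + 1) := by
  set D := unif (row N n) (row_nonempty N hn) with hD
  set v : ℝ := 100 * √((N : ℝ) + 1) / (m + 1) with hv
  have hv0 : 0 ≤ v := by positivity
  let E : Set (Fin m → ℕ × ℕ) := {s | ¬ Function.Injective s}
  let G : Set (Fin m → ℕ × ℕ) := {s | ∀ i, s i ∈ row N n}ᶜ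
  have hint : ∀ B : Set (Fin m → ℕ × ℕ),
      Integrable (fun s => B.indicator (fun _ => (1 : ℝ)) s) (iid D m) := fun B =>
    integrable_of_abs_le _ _ 1 fun s => by by_cases hs : s ∈ B <;> simp [hs]
  have hpt : ∀ s : Fin m → ℕ × ℕ, (birthdayCertifier m s : ℝ)
      ≤ E.indicator (fun _ => (1 : ℝ)) s + G.indicator (fun _ => (1 : ℝ)) s + v := by
    intro s
    have hE0 : 0 ≤ E.indicator (fun _ => (1 : ℝ)) s :=
      Set.indicator_nonneg (fun _ _ => zero_le_one) _
    have hG0 : 0 ≤ G.indicator (fun _ => (1 : ℝ)) s :=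
      Set.indicator_nonneg (fun _ _ => zero_le_one) _
    have h1 := (birthdayCertifier m s).2.2
    by_cases hs : Function.Injective s
    · by_cases hr : ∀ i, s i ∈ row N n
      · have hsup : (Finset.univ.sup fun i => (s i).1) ≤ N :=
          Finset.sup_le fun i _ => (fst_of_mem_row (hr i)).le
        have h2 : (birthdayCertifier m s : ℝ) ≤ v := by
          simp only [birthdayCertifier, if_pos hs]
          refine (min_le_right _ _).trans ?_
          rw [hv]
          gcongr
        linarith
      · have : G.indicator (fun _ => (1 : ℝ)) s = 1 := Set.indicator_of_mem (by exact hr) _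
        linarith
    · have : E.indicator (fun _ => (1 : ℝ)) s = 1 := Set.indicator_of_mem (by exact hs) _
      linarith
  calc (expect D m fun s => (birthdayCertifier m s : ℝ))
      ≤ ∫ s, (E.indicator (fun _ => (1 : ℝ)) s + G.indicator (fun _ => (1 : ℝ)) s + v)
          ∂(iid D m) :=
        integral_mono (integrable_birthdayCertifier D m)
          (((hint E).add (hint G)).add (integrable_const _)) hpt
    _ = (iid D m).real E + (iid D m).real G + v := by
        have hEG : Integrable (fun s => E.indicator (fun _ => (1 : ℝ)) s
            + G.indicator (fun _ => (1 : ℝ)) s) (iid D m) := (hint E).add (hint G)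
        rw [integral_add hEG (integrable_const _), integral_add (hint E) (hint G),
          integral_indicator_const_one,
          integral_indicator_const_one]
        simp
    _ ≤ (m : ℝ) ^ 2 / n + 0 + v := by
        have h1 := iid_unif_not_injective_le (row N n) (row_nonempty N hn) m
        rw [card_row] at h1
        have h2 := iid_unif_not_forall_mem (row N n) (row_nonempty N hn) m
        gcongr
        exact h2.le
    _ = _ := by rw [add_zero]

/-- The rate certified by the birthday certifier. -/
noncomputable def birthdayRate (D : ProbabilityMeasure (ℕ × ℕ)) (m : ℕ) : unitInterval :=
  ⟨expect D m fun s => (birthdayCertifier m s : ℝ),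
    integral_mem_unitInterval _ _ (fun s => (birthdayCertifier m s).2.1)
      fun s => (birthdayCertifier m s).2.2⟩

lemma certifiedAt_birthdayRate (D : ProbabilityMeasure (ℕ × ℕ)) :
    CertifiedAt sparseClass (majority (ℕ × ℕ)) D (birthdayRate D) :=
  ⟨birthdayCertifier, isSound_birthdayCertifier, fun _ => le_rfl⟩

/-- Functions of order `m ^ (2 - β)` fall below any multiple of `m²` along any arithmetic
progression `K * j`. -/
lemma exists_lt_sq {f : ℕ → ℕ} {β : ℝ} (hβ : 0 < β)
    (hf : (fun m : ℕ => (f m : ℝ)) =O[atTop] fun m : ℕ => (m : ℝ) ^ (2 - β)) {K : ℕ}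
    (hK : 0 < K) : ∃ j : ℕ, 0 < j ∧ f (K * j) < j ^ 2 := by
  have hK' : (0 : ℝ) < K := by exact_mod_cast hK
  have ho : (fun m : ℕ => (m : ℝ) ^ (2 - β)) =o[atTop] fun m : ℕ => (m : ℝ) ^ (2 : ℝ) := by
    have h := (Asymptotics.isBigO_refl (fun m : ℕ => (m : ℝ) ^ (2 : ℝ)) atTop).mul_isLittleO
      ((Asymptotics.isLittleO_one_iff ℝ).2
        ((tendsto_rpow_neg_atTop hβ).comp tendsto_natCast_atTop_atTop))
    refine h.congr' ?_ (by simp)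
    filter_upwards [eventually_gt_atTop 0] with m hm
    have hm' : (0 : ℝ) < m := by exact_mod_cast hm
    rw [Function.comp_apply, ← Real.rpow_add hm', sub_eq_add_neg]
  have h1 := (hf.trans_isLittleO ho).def (c := 1 / (2 * (K : ℝ) ^ 2)) (by positivity)
  have h2 : Tendsto (fun j : ℕ => K * j) atTop atTop := tendsto_id.const_mul_atTop' hK
  obtain ⟨j, hj, hj0⟩ := ((h2.eventually h1).and (eventually_gt_atTop 0)).exists
  refine ⟨j, hj0, ?_⟩
  have hj' : (0 : ℝ) < j := by exact_mod_cast hj0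
  rw [Real.norm_of_nonneg (Nat.cast_nonneg _), Real.rpow_two,
    Real.norm_of_nonneg (by positivity)] at hj
  have h3 : 1 / (2 * (K : ℝ) ^ 2) * ((K * j : ℕ) : ℝ) ^ 2 = (j : ℝ) ^ 2 / 2 := by
    push_cast
    field_simp
  have h4 : (f (K * j) : ℝ) < (j : ℝ) ^ 2 := by
    rw [h3] at hj
    have : (0 : ℝ) < (j : ℝ) ^ 2 := by positivity
    linarith
  exact_mod_cast h4

/-- The hard distributions: uniform on a long row, with `M` larger than `σ m η` but small
compared with `m²`. -/
theorem exists_hard_row {α : ℝ} (hα : 0 < α) {β : ℝ} (hβ : 0 < β)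
    {σ : ℕ → Set.Ioo (0 : ℝ) 1 → ℕ}
    (hσ : ∀ η : Set.Ioo (0 : ℝ) 1,
      (fun m : ℕ => (σ m η : ℝ)) =O[atTop] fun m : ℕ => (m : ℝ) ^ (2 - β)) :
    ∃ (Y : Finset (ℕ × ℕ)) (hY : Y.Nonempty) (M m : ℕ) (η : Set.Ioo (0 : ℝ) 1)
      (ε : ProbabilityMeasure (ℕ × ℕ) → ℕ → unitInterval),
      (∀ D, CertifiedAt sparseClass (majority (ℕ × ℕ)) D (ε D)) ∧
      (∀ h ∈ sparseClass, minorityCount h Y ≤ M) ∧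
      (∀ T : Finset (ℕ × ℕ), T ⊆ Y → T.card ≤ M → Shatters sparseClass T) ∧
      σ m η < M ∧
      α * (ε (unif Y hY) m : ℝ) + (η : ℝ) < 1 / 4 ∧
      ∀ k < M,
        1 / 4 ≤ ermErrorRate sparseClass (unif Y hY) k ∧
        ∀ A : RandLearner (ℕ × ℕ), IsOIG sparseClass A →
          1 / 4 ≤ errorRate sparseClass A (unif Y hY) k := by
  -- `M = j ^ 2` and `m = K * j`, so that the rate `√M / m` is about `1 / K`
  let η : Set.Ioo (0 : ℝ) 1 := ⟨1 / 8, by norm_num, by norm_num⟩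
  obtain ⟨K, hK⟩ := exists_nat_gt (6400 * α)
  have hK0' : (0 : ℝ) < K := by linarith
  have hK0 : 0 < K := by exact_mod_cast hK0'
  obtain ⟨j, hj0, hj⟩ := exists_lt_sq hβ (hσ η) hK0
  have hj1 : (1 : ℝ) ≤ j := by exact_mod_cast hj0
  set m := K * j with hm
  obtain ⟨L, hL⟩ := exists_nat_gt (32 * α * (m : ℝ) ^ 2)
  set n := 2 * (j ^ 2) ^ 2 + L with hndef
  have hn : 0 < n := by positivity
  have hrowcard : ∀ k < j ^ 2, 2 * (k + 1) ^ 2 ≤ (row (j ^ 2) n).card := by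
    intro k hk
    rw [card_row]
    have : (k + 1) ^ 2 ≤ (j ^ 2) ^ 2 := Nat.pow_le_pow_left hk 2
    omega
  refine ⟨row (j ^ 2) n, row_nonempty _ hn, j ^ 2, m, η, birthdayRate, certifiedAt_birthdayRate,
    fun h hh => minorityCount_sparseClass_le hh _ _,
    fun T hT hcard => shatters_sparseClass (fun x hx => fst_of_mem_row (hT hx)) hcard, hj, ?_,
    fun k hk => ⟨?_, fun A hA => ?_⟩⟩
  · have hrate := expect_birthdayCertifier_unif_le (N := j ^ 2) hn m
    change ((birthdayRate (unif (row (j ^ 2) n) (row_nonempty _ hn)) m : unitInterval) : ℝ) ≤ _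
      at hrate
    have hn' : (0 : ℝ) < n := by exact_mod_cast hn
    have h1 : α * ((m : ℝ) ^ 2 / n) ≤ 1 / 32 := by
      rw [← mul_div_assoc, div_le_iff₀ hn']
      have : (L : ℝ) ≤ n := by exact_mod_cast Nat.le_add_left _ _
      linarith
    have h2 : √(((j ^ 2 : ℕ) : ℝ) + 1) ≤ 2 * j := by
      rw [Real.sqrt_le_left (by positivity)]
      push_cast
      nlinarith
    have h3 : α * (100 * √(((j ^ 2 : ℕ) : ℝ) + 1) / (m + 1)) ≤ 1 / 32 := by
      rw [← mul_div_assoc, div_le_iff₀ (by positivity), hm]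
      push_cast
      have h4 := mul_le_mul_of_nonneg_left h2 hα.le
      push_cast at h4
      nlinarith
    have h5 := mul_le_mul_of_nonneg_left hrate hα.le
    rw [mul_add] at h5
    have hη : (η : ℝ) = 1 / 8 := rfl
    rw [hη]
    linarith
  · refine quarter_le_ermErrorRate _ _ const_false_mem_sparseClass ?_ ?_
    · have := hrowcard k hk
      nlinarith
    · intro T f hT hcard hf
      refine ⟨true, j ^ 2, T, fun x hx => fst_of_mem_row (hT hx), hcard.trans hk.le,
        fun x hx => ?_⟩
      by_contra hfx
      exact hx ((hf x).1 (by simpa using hfx))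
  · exact quarter_le_errorRate_of_isOIG _ _ ⟨_, const_false_mem_sparseClass⟩ hA (hrowcard k hk)
      fun T hT hcard => shatters_sparseClass (fun x hx => fst_of_mem_row (hT hx))
        (hcard.trans hk)

end RelSmart

theorem theorem3p1 :
    ∃ (X : Type) (_ : Countable X) (_ : MeasurableSpace X) (_ : DiscreteMeasurableSpace X)
      (H : Set (X → Bool)),
      -- OIG learners exist, so that the claims about all of them are not void
      (∃ A : RelSmart.RandLearner X, RelSmart.IsOIG H A) ∧
      ∀ α : ℝ, 0 < α → ∀ β : ℝ, 0 < β → ∀ σ : ℕ → Set.Ioo (0 : ℝ) 1 → ℕ,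
        (∀ η : Set.Ioo (0 : ℝ) 1,
          (fun m : ℕ => (σ m η : ℝ)) =O[atTop] fun m : ℕ => (m : ℝ) ^ (2 - β)) →
        -- neither ERM nor OIG is relatively smart
        ¬ RelSmart.IsRelativelySmartRate H (RelSmart.ermErrorRate H) α σ ∧
        (∀ A : RelSmart.RandLearner X, RelSmart.IsOIG H A →
          ¬ RelSmart.IsRelativelySmart H A α σ) ∧
        -- the rate that they miss is certifiable for the majority learner
        ∃ (Y : Finset X) (hY : Y.Nonempty) (M m : ℕ) (η : Set.Ioo (0 : ℝ) 1)
          (ε : ProbabilityMeasure X → ℕ → unitInterval),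
          (∀ D : ProbabilityMeasure X,
            RelSmart.CertifiedAt H (RelSmart.majority X) D (ε D)) ∧
          (∀ h ∈ H, RelSmart.minorityCount h Y ≤ M) ∧
          (∀ T : Finset X, T ⊆ Y → T.card ≤ M → RelSmart.Shatters H T) ∧
          σ m η < M ∧
          α * (ε (RelSmart.unif Y hY) m : ℝ) + (η : ℝ) < 1 / 4 ∧
          ∀ k < M,
            1 / 4 ≤ RelSmart.ermErrorRate H (RelSmart.unif Y hY) k ∧
            ∀ A : RelSmart.RandLearner X, RelSmart.IsOIG H A →
              1 / 4 ≤ RelSmart.errorRate H A (RelSmart.unif Y hY) k := by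
  open RelSmart in
  refine ⟨ℕ × ℕ, inferInstance, inferInstance, inferInstance, sparseClass,
    exists_isOIG ⟨_, const_false_mem_sparseClass⟩, ?_⟩
  intro α hα β hβ σ hσ
  have hmain := exists_hard_row hα hβ hσ
  refine ⟨?_, ?_, hmain⟩
  · obtain ⟨Y, hY, M, m, η, ε, hcert, -, -, hσM, hlt, hlow⟩ := hmain
    intro hsmart
    have h1 := hsmart ε (fun D => ⟨_, hcert D⟩) (unif Y hY) m η
    linarith [(hlow _ hσM).1]
  · obtain ⟨Y, hY, M, m, η, ε, hcert, -, -, hσM, hlt, hlow⟩ := hmain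
    intro A hA hsmart
    have h1 := hsmart ε (fun D => ⟨_, hcert D⟩) (unif Y hY) m η
    linarith [(hlow _ hσM).2 A hA]
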